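/- Notation. For a function $f:(0,\infty)\to\mathbb C$ of bounded variation on $(0,\infty)$ let $\mu_f$ (also written $df$) be the complex Borel measure on $(0,\infty)$ with $\mu_f((a,b])=f(b+)-f(a+)$ for $0<a\le b$. For $1\le p\le\infty$ and a complex Borel measure $\mu$ on $\mathbb R$ put $$\|\mu\|_p^*=\sup\Big\{\Big|\int_{\mathbb R}h\,d\mu\Big| \;:\; h\in\mathcal S(\mathbb R),\ \|\widehat h\|_{L^p(\mathbb R)}\le 1\Big\},\qquad \widehat h(y)=\int_{\mathbb R}h(x)e^{-2\pi i xy}\,dx,$$ where $\mathcal S(\mathbb R)$ is the space of complex-valued Schwartz functions, and put $$\|f\|_{V_p^*}=\int_0^\infty x^{-1/p}\,\|\chi_{(x,2x)}\mu_f\|_p^*\,dx\in[0,\infty]\qquad(1/\infty=0).$$ Theorem. Let $1<p\le\infty$. There is a constant $C=C_p<\infty$, depending only on $p$, such that the following holds. Let $f:(0,\infty)\to\mathbb C$ be of bounded variation on $(0,\infty)$ with $\lim_{t\to\infty}f(t)=0$ and $\|f\|_{V_p^*}<\infty$, and let $\gamma=0$ or $\gamma=\frac14$. Then for every $x>0$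 the transform $$\widehat f_\gamma(x)=\int_0^\infty f(t)\cos 2\pi(xt-\gamma)\,dt=\lim_{R\to\infty}\int_0^R f(t)\cos2\pi(xt-\gamma)\,dt$$ (the cosine transform for $\gamma=0$, the sine transform for $\gamma=\frac14$) exists, and $$\widehat f_\gamma(x)=\frac1{2\pi x}\,f\Big(\frac1x\Big)\sin 2\pi\gamma+\Gamma(x),\qquad x>0,$$ where $\Gamma$ is Lebesgue integrable on $(0,\infty)$ and $\|\Gamma\|_{L^1(0,\infty)}\le C\,\|f\|_{V_p^*}$. No absolute continuity of $f$ is assumed. -/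

import Mathlib

open Set Filter Topology MeasureTheory
open scoped ENNReal NNReal SchwartzMap FourierTransform

/-- If `f` has bounded variation on the open half-line `(0, ∞)`, then its extension by zero to `ℝ`
has bounded variation on `ℝ`. -/
theorem BoundedVariationOn.indicator_Ioi_zero {f : ℝ → ℂ} (hf : BoundedVariationOn f (Ioi 0)) :
    BoundedVariationOn ((Ioi (0 : ℝ)).indicator f) univ := by
  have hg : BoundedVariationOn ((Ioi (0 : ℝ)).indicator f) (Ioi 0) := by
    have h : eVariationOn ((Ioi (0 : ℝ)).indicator f) (Ioi 0) = eVariationOn f (Ioi 0) :=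
      eVariationOn.congr (fun x hx => indicator_of_mem hx f)
    unfold BoundedVariationOn
    rw [h]
    exact hf
  obtain ⟨l, hl⟩ := hg.exists_tendsto_right (x := 0)
  have h1 : eVariationOn ((Ioi (0 : ℝ)).indicator f) (Iic 0) = 0 := by
    apply eVariationOn.constant_on
    rintro _ ⟨x, hx, rfl⟩ _ ⟨y, hy, rfl⟩
    rw [indicator_of_notMem (by simpa using hx), indicator_of_notMem (by simpa using hy)]
  have h2 := eVariationOn.eVariationOn_on_inter_Ici_eq_Ioi_add_edist
    (f := (Ioi (0 : ℝ)).indicator f) (s := univ) (a := 0) (l := l)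
    (by rw [univ_inter]; infer_instance) (mem_univ _) (by simpa using hl)
  rw [univ_inter, univ_inter] at h2
  unfold BoundedVariationOn
  rw [← Iic_union_Ici (a := (0 : ℝ)), eVariationOn.union _ isGreatest_Iic isLeast_Ici, h1, h2,
    zero_add]
  exact ENNReal.add_ne_top.2 ⟨hg, edist_ne_top _ _⟩

/-- The complex Borel measure `μ_f = df` on `(0, ∞)` generated by a function `f` of bounded
variation on `(0, ∞)`: it gives the mass `f(b+) - f(a+)` to `(a, b]` for `0 < a ≤ b`, and no mass
to `(-∞, 0]`. -/
noncomputable def bvMeasure {f : ℝ → ℂ} (hf : BoundedVariationOn f (Ioi 0)) : ComplexMeasure ℝ :=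
  VectorMeasure.restrict (BoundedVariationOn.vectorMeasure hf.indicator_Ioi_zero) (Ioi 0)

/-- The functional `‖μ‖_p^* = sup |∫ h dμ|`, the supremum being over the functions `h` in the unit
ball of `L̂^{p'}`, whose norm is `‖h‖_{L̂^{p'}} = ‖ĥ‖_p` (`p'` the conjugate exponent of `p`).
As `μ` may be singular, `h` has to be defined at each point and not only almost everywhere; it runs
over the Schwartz functions, which are dense in `L̂^{p'}`. The Fourier transform is
`ĥ(y) = ∫ h(x) e^{-2πixy} dx`. -/
noncomputable def starNorm (p : ℝ≥0∞) (μ : ComplexMeasure ℝ) : ℝ≥0∞ :=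
  ⨆ (h : 𝓢(ℝ, ℂ)) (_ : eLpNorm (fun y : ℝ => 𝓕 (fun x : ℝ => h x) y) p volume ≤ 1),
    ‖∫ᵛ t, h t ∂[ContinuousLinearMap.mul ℝ ℂ; μ]‖ₑ

/-- `‖f‖_{V_p^*} = ∫_0^∞ x^{-1/p} ‖χ_{(x,2x)} μ_f‖_p^* dx`, with `1/∞ = 0`. -/
noncomputable def vStarNorm (p : ℝ≥0∞) {f : ℝ → ℂ} (hf : BoundedVariationOn f (Ioi 0)) : ℝ≥0∞ :=
  ∫⁻ x in Ioi (0 : ℝ), ENNReal.ofReal (x ^ (-(p⁻¹).toReal)) *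
    starNorm p (VectorMeasure.restrict (bvMeasure hf) (Ioo x (2 * x)))

/-- `F` is the transform `f̂_γ(x) = ∫_0^∞ f(t) cos 2π(xt - γ) dt`, `x > 0`, of `f`, the integral
being improper at infinity (`γ = 0`: cosine transform, `γ = 1/4`: sine transform). -/
def IsTrigTransform (γ : ℝ) (f F : ℝ → ℂ) : Prop :=
  ∀ x : ℝ, 0 < x →
    (∀ R : ℝ, 0 < R → IntegrableOn
      (fun t => f t * (Real.cos (2 * Real.pi * (x * t - γ)) : ℂ)) (Ioc 0 R) volume) ∧
    Tendsto (fun R : ℝ => ∫ t in Ioc 0 R, f t * (Real.cos (2 * Real.pi * (x * t - γ)) : ℂ))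
      atTop (𝓝 (F x))

/-! Write `df = θ dm` with `m` finite and positive. Since `f` vanishes at infinity, `f(t) = -∫_{s>t}
θ dm` for almost every `t`, and Fubini gives the transform as `-(2πx)⁻¹ ∫ k(xs) θ(s) dm(s)` with
`k(v) = sin 2π(v-γ) + sin 2πγ`. The main term has the same form with kernel `sin 2πγ · 1_{s>1/x}`.
So for almost every `x`, `Γ(x)` is `-(2πx)⁻¹` times the integral of the difference of the kernels:
it equals `k(xs) = O(xs)` when `xs ≤ 1` and the pure wave `sin 2π(xs-γ)` when `xs > 1`.

Let the measure live on one octave `(u, 2u)`, and let `N` be its star norm. For `x ≤ 1/u` the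
integral is a pairing with `k(x·)` and with a half-line. Localised smoothly to the octave, these
have Fourier transforms of size `O(A u (1+u²ξ²)^{-1/2})`, where `A` bounds the function and its
variation; the half-line is reached through smooth steps of bounded variation. This weight is in
`L^p` because `p > 1`, with norm of order `u^{1-1/p}`. Hence `Γ = O(u · u^{1-1/p} N)` on an interval
of length `1/u`. For `x > 1/u` only the wave remains and `1/x` is dominated by the same weight, so
the integral of `|Γ|` is controlled by a weighted `L¹` norm of the Fourier transform of the measure.
By duality and the multiplication formula this is a pairing of the measure with functions whose
transform is below the weight, again `O(u^{1-1/p} N)` (`lintegral_charInt_le`).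

Every `s > 0` lies in `(u, 2u)` for a set of `u` of `du/u`-mass `log 2`. Averaging the octave bound
(`lintegral_remainder_octave_le`) against `du/u` turns `u^{1-1/p}` into `u^{-1/p}`, which is the
weight in the `V_p^*` norm. -/

/-! ### Complex measures as densities -/

/-- Every complex measure has a density with respect to some finite positive measure. -/
theorem exists_eq_withDensityᵥ {α : Type*} [MeasurableSpace α] (c : ComplexMeasure α) :
    ∃ (m : Measure α) (θ : α → ℂ), IsFiniteMeasure m ∧ Measurable θ ∧ Integrable θ m ∧
      c = m.withDensityᵥ θ := by
  set r : SignedMeasure α := ComplexMeasure.re c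
  set i : SignedMeasure α := ComplexMeasure.im c
  -- The sum of the total variations dominates both the real and the imaginary part.
  set m : Measure α := r.totalVariation + i.totalVariation with hm
  have : IsFiniteMeasure r.totalVariation := by
    unfold SignedMeasure.totalVariation; infer_instance
  have : IsFiniteMeasure i.totalVariation := by
    unfold SignedMeasure.totalVariation; infer_instance
  have hr : r ≪ᵥ m.toENNRealVectorMeasure := by
    refine VectorMeasure.AbsolutelyContinuous.mk fun s hs h => ?_
    rw [Measure.toENNRealVectorMeasure_apply_measurable hs, hm, Measure.add_apply,
      add_eq_zero] at h
    exact SignedMeasure.null_of_totalVariation_zero _ h.1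
  have hi : i ≪ᵥ m.toENNRealVectorMeasure := by
    refine VectorMeasure.AbsolutelyContinuous.mk fun s hs h => ?_
    rw [Measure.toENNRealVectorMeasure_apply_measurable hs, hm, Measure.add_apply,
      add_eq_zero] at h
    exact SignedMeasure.null_of_totalVariation_zero _ h.2
  refine ⟨m, c.rnDeriv m, inferInstance, ?_, c.integrable_rnDeriv m, ?_⟩
  · have h1 : Measurable (fun x => ((r.rnDeriv m x : ℝ) : ℂ)) :=
      Complex.measurable_ofReal.comp (SignedMeasure.measurable_rnDeriv _ _)
    have h2 : Measurable (fun x => ((i.rnDeriv m x : ℝ) : ℂ)) :=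
      Complex.measurable_ofReal.comp (SignedMeasure.measurable_rnDeriv _ _)
    have e : c.rnDeriv m = fun x => ((r.rnDeriv m x : ℝ) : ℂ) + (i.rnDeriv m x : ℝ) * Complex.I :=
      funext fun x => (Complex.re_add_im _).symm
    rw [e]
    exact h1.add (h2.mul_const Complex.I)
  · conv_lhs => rw [← c.toComplexMeasure_to_signedMeasure]
    ext s hs : 1
    rw [SignedMeasure.toComplexMeasure_apply, withDensityᵥ_apply (c.integrable_rnDeriv m) hs]
    apply Complex.ext
    · rw [← RCLike.re_eq_complex_re, ← integral_re (c.integrable_rnDeriv m).integrableOn]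
      change r s = ∫ x in s, r.rnDeriv m x ∂m
      rw [← withDensityᵥ_apply (SignedMeasure.integrable_rnDeriv _ _) hs,
        SignedMeasure.withDensityᵥ_rnDeriv_eq _ _ hr]
    · rw [← RCLike.im_eq_complex_im, ← integral_im (c.integrable_rnDeriv m).integrableOn]
      change i s = ∫ x in s, i.rnDeriv m x ∂m
      rw [← withDensityᵥ_apply (SignedMeasure.integrable_rnDeriv _ _) hs,
        SignedMeasure.withDensityᵥ_rnDeriv_eq _ _ hi]

/-- Integration of a bounded function against a complex measure with a density. -/
theorem integral_withDensityᵥ_mul {α : Type*} [MeasurableSpace α] {m : Measure α} {θ : α → ℂ}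
    (hθ : Integrable θ m) {h : α → ℂ} (hh : StronglyMeasurable h) {C : ℝ}
    (hC : ∀ x, ‖h x‖ ≤ C) :
    ∫ᵛ t, h t ∂[ContinuousLinearMap.mul ℝ ℂ; m.withDensityᵥ θ] = ∫ t, h t * θ t ∂m := by
  have : IsFiniteMeasure (m.withDensityᵥ θ).variation := by
    rw [Measure.variation_withDensityᵥ hθ]
    exact isFiniteMeasure_withDensity hθ.2.ne
  -- Both sides agree on simple functions; approximants bounded by the same `C` then allow dominated
  -- convergence on both sides.
  have key : ∀ g : SimpleFunc α ℂ,
      ∫ᵛ t, g t ∂[ContinuousLinearMap.mul ℝ ℂ; m.withDensityᵥ θ] = ∫ t, g t * θ t ∂m := by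
    intro g
    induction g using SimpleFunc.induction with
    | const c hs =>
      rename_i s
      simp only [SimpleFunc.coe_piecewise, SimpleFunc.coe_const,
        Function.const_zero, piecewise_eq_indicator]
      have h1 : (fun t => s.indicator (Function.const α c) t * θ t)
          = s.indicator (fun t => c * θ t) := by
        ext t; by_cases ht : t ∈ s <;> simp [ht]
      rw [h1, MeasureTheory.integral_indicator hs, MeasureTheory.integral_const_mul]
      have h2 := VectorMeasure.integral_indicator_const (μ := m.withDensityᵥ θ)
        (B := ContinuousLinearMap.mul ℝ ℂ) c hs
      rw [withDensityᵥ_apply hθ hs] at h2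
      exact h2
    | @add f g _ hf hg =>
      simp only [SimpleFunc.coe_add, Pi.add_apply, add_mul]
      have hbd : ∀ q : SimpleFunc α ℂ, Integrable (fun t => q t * θ t) m := by
        intro q
        obtain ⟨D, hD⟩ := q.exists_forall_norm_le
        exact hθ.bdd_mul q.aestronglyMeasurable (ae_of_all _ hD)
      rw [MeasureTheory.integral_add (hbd f) (hbd g), ← hf, ← hg]
      exact VectorMeasure.integral_fun_add (SimpleFunc.integrable_of_isFiniteMeasure f)
        (SimpleFunc.integrable_of_isFiniteMeasure g)
  by_cases hne : Nonempty α
  swap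
  · have : IsEmpty α := not_nonempty_iff.1 hne
    simp [VectorMeasure.integral_of_isEmpty, Measure.eq_zero_of_isEmpty m]
  have hC0 : 0 ≤ C := (norm_nonneg _).trans (hC hne.some)
  have l1 : Tendsto (fun n => ∫ᵛ t, hh.approxBounded C n t
      ∂[ContinuousLinearMap.mul ℝ ℂ; m.withDensityᵥ θ]) atTop
      (𝓝 (∫ᵛ t, h t ∂[ContinuousLinearMap.mul ℝ ℂ; m.withDensityᵥ θ])) :=
    VectorMeasure.tendsto_integral_of_dominated_convergence (fun _ => C)
      (fun n => SimpleFunc.aestronglyMeasurable _) (integrable_const _)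
      (fun n => ae_of_all _ fun x => StronglyMeasurable.norm_approxBounded_le hh hC0 n x)
      (ae_of_all _ fun x => StronglyMeasurable.tendsto_approxBounded_of_norm_le hh (hC x))
  have l2 : Tendsto (fun n => ∫ t, hh.approxBounded C n t * θ t ∂m) atTop
      (𝓝 (∫ t, h t * θ t ∂m)) := by
    refine tendsto_integral_of_dominated_convergence (fun t => C * ‖θ t‖)
      (fun n => (SimpleFunc.aestronglyMeasurable _).mul hθ.1) (hθ.norm.const_mul C)
      (fun n => ae_of_all _ fun x => ?_) (ae_of_all _ fun x => ?_)
    · rw [norm_mul]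
      exact mul_le_mul_of_nonneg_right (StronglyMeasurable.norm_approxBounded_le hh hC0 n x)
        (norm_nonneg _)
    · exact (StronglyMeasurable.tendsto_approxBounded_of_norm_le hh (hC x)).mul_const _
  refine tendsto_nhds_unique l1 ?_
  simp_rw [key]
  exact l2

theorem withDensityᵥ_restrict {α : Type*} [MeasurableSpace α] {m : Measure α} {θ : α → ℂ}
    (hθ : Integrable θ m) {s : Set α} (hs : MeasurableSet s) :
    (m.withDensityᵥ θ).restrict s = (m.restrict s).withDensityᵥ θ := by
  ext t ht : 1
  rw [VectorMeasure.restrict_apply _ hs ht, withDensityᵥ_apply hθ (ht.inter hs),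
    withDensityᵥ_apply hθ.integrableOn ht, Measure.restrict_restrict ht]

/-- The defining inequality of `starNorm`, in homogeneous form, for a measure with a density. -/
theorem enorm_integral_mul_le_starNorm {m : Measure ℝ} {θ : ℝ → ℂ} (hθ : Integrable θ m)
    (p : ℝ≥0∞) (h : 𝓢(ℝ, ℂ)) {A : ℝ} (hA : 0 < A)
    (hh : eLpNorm (fun y : ℝ => 𝓕 (fun x : ℝ => h x) y) p volume ≤ ENNReal.ofReal A) :
    ‖∫ t, h t * θ t ∂m‖ₑ ≤ ENNReal.ofReal A * starNorm p (m.withDensityᵥ θ) := by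
  set c : ℂ := ((A⁻¹ : ℝ) : ℂ) with hc
  have hcn : ‖c‖ₑ = (ENNReal.ofReal A)⁻¹ := by
    rw [hc, ← ofReal_norm, Complex.norm_real, Real.norm_of_nonneg (inv_nonneg.2 hA.le),
      ENNReal.ofReal_inv_of_pos hA]
  have hA0 : ENNReal.ofReal A ≠ 0 := by simpa using hA
  have h1 : eLpNorm (fun y : ℝ => 𝓕 (fun x : ℝ => (c • h) x) y) p volume ≤ 1 := by
    have e1 : (fun y : ℝ => 𝓕 (fun x : ℝ => (c • h) x) y)
        = c • fun y : ℝ => 𝓕 (fun x : ℝ => h x) y := by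
      ext y
      rw [Pi.smul_apply, Real.fourier_eq, Real.fourier_eq, ← integral_smul]
      congr 1; ext v
      simp only [smul_apply, smul_eq_mul, Circle.smul_def]
      ring
    rw [e1, eLpNorm_const_smul, hcn]
    calc _ ≤ (ENNReal.ofReal A)⁻¹ * ENNReal.ofReal A := by gcongr
      _ = 1 := ENNReal.inv_mul_cancel hA0 ENNReal.ofReal_ne_top
  have h2 : ‖∫ᵛ t, (c • h) t ∂[ContinuousLinearMap.mul ℝ ℂ; m.withDensityᵥ θ]‖ₑ
      ≤ starNorm p (m.withDensityᵥ θ) := by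
    unfold starNorm
    exact le_iSup₂_of_le (c • h) h1 le_rfl
  rw [integral_withDensityᵥ_mul hθ (c • h).continuous.stronglyMeasurable
    (C := ‖(c • h).toBoundedContinuousFunction‖)
    (fun x => BoundedContinuousFunction.norm_coe_le_norm (c • h).toBoundedContinuousFunction x)]
    at h2
  have e2 : ∫ t, (c • h) t * θ t ∂m = c * ∫ t, h t * θ t ∂m := by
    rw [← MeasureTheory.integral_const_mul]
    congr 1; ext t
    simp [mul_assoc]
  rw [e2, enorm_mul, hcn] at h2
  calc ‖∫ t, h t * θ t ∂m‖ₑ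
      = ENNReal.ofReal A * ((ENNReal.ofReal A)⁻¹ * ‖∫ t, h t * θ t ∂m‖ₑ) := by
        rw [← mul_assoc, ENNReal.mul_inv_cancel hA0 ENNReal.ofReal_ne_top, one_mul]
    _ ≤ _ := by gcongr

/-! ### Recovering the function from its measure -/

/-- The measure sees only right limits, so continuity at `t` is what identifies `f(t)` itself. -/
theorem bvMeasure_Ioi {f : ℝ → ℂ} (hf : BoundedVariationOn f (Ioi 0))
    (hlim : Tendsto f atTop (𝓝 0)) {t : ℝ} (ht : 0 < t)
    (hc : ContinuousAt ((Ioi (0 : ℝ)).indicator f) t) :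
    bvMeasure hf (Ioi t) = - f t := by
  have hg : Tendsto ((Ioi (0 : ℝ)).indicator f) atTop (𝓝 0) := by
    refine hlim.congr' ?_
    filter_upwards [eventually_gt_atTop 0] with x hx
    rw [indicator_of_mem (show x ∈ Ioi (0 : ℝ) from hx)]
  unfold bvMeasure
  rw [VectorMeasure.restrict_apply _ measurableSet_Ioi measurableSet_Ioi,
    inter_eq_self_of_subset_left (Ioi_subset_Ioi ht.le), BoundedVariationOn.vectorMeasure_Ioi,
    hg.limUnder_eq, rightLim_eq_of_tendsto (hc.tendsto.mono_left nhdsWithin_le_nhds),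
    indicator_of_mem (show t ∈ Ioi (0 : ℝ) from ht), zero_sub]

/-- A function of bounded variation on the half-line that vanishes at infinity is recovered almost
everywhere from its measure. -/
theorem ae_eq_neg_setIntegral_density {f : ℝ → ℂ} (hf : BoundedVariationOn f (Ioi 0))
    (hlim : Tendsto f atTop (𝓝 0)) {m : Measure ℝ} {θ : ℝ → ℂ} (hθ : Integrable θ m)
    (hμ : bvMeasure hf = m.withDensityᵥ θ) :
    ∀ᵐ t : ℝ, 0 < t → f t = - ∫ s in Ioi t, θ s ∂m := by
  -- Bounded variation gives differentiability, hence continuity, almost everywhere.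
  have h := hf.indicator_Ioi_zero.locallyBoundedVariationOn.ae_differentiableWithinAt_of_mem
  filter_upwards [h] with t ht h0
  have hc : ContinuousAt ((Ioi (0 : ℝ)).indicator f) t :=
    (differentiableWithinAt_univ.1 (ht (mem_univ t))).continuousAt
  rw [← withDensityᵥ_apply hθ measurableSet_Ioi, ← hμ, bvMeasure_Ioi hf hlim h0 hc, neg_neg]

/-- Inversion is differentiable off `0`, so it maps null sets to null sets. The main term evaluates
`f` at `1/x`. -/
theorem ae_inv_of_ae {P : ℝ → Prop} (h : ∀ᵐ t : ℝ, 0 < t → P t) :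
    ∀ᵐ x : ℝ, 0 < x → P (1 / x) := by
  have h0 : volume ({t : ℝ | 0 < t ∧ ¬ P t}) = 0 := by
    rw [ae_iff] at h
    simpa using h
  have h1 : volume ((fun x : ℝ => x⁻¹) '' {t : ℝ | 0 < t ∧ ¬ P t}) = 0 := by
    refine addHaar_image_eq_zero_of_differentiableOn_of_addHaar_eq_zero _ ?_ h0
    intro t ht
    exact (differentiableAt_inv ht.1.ne').differentiableWithinAt
  rw [ae_iff]
  refine measure_mono_null ?_ h1
  intro x hx
  simp only [mem_ofPred_eq, Classical.not_imp] at hx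
  exact ⟨1 / x, ⟨one_div_pos.2 hx.1, hx.2⟩, by simp⟩

/-! ### The transform as an integral against the measure -/

/-- The kernel `2πx ∫_0^s cos 2π(xt - γ) dt`, as a function of `xs`. -/
noncomputable def trigKernel (γ t : ℝ) : ℝ :=
  Real.sin (2 * Real.pi * (t - γ)) + Real.sin (2 * Real.pi * γ)

theorem continuous_trigKernel (γ : ℝ) : Continuous (trigKernel γ) := by
  unfold trigKernel; fun_prop

theorem abs_trigKernel_le_two (γ t : ℝ) : |trigKernel γ t| ≤ 2 := by
  unfold trigKernel
  have h1 := abs_add_le (Real.sin (2 * Real.pi * (t - γ))) (Real.sin (2 * Real.pi * γ))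
  have h2 := Real.abs_sin_le_one (2 * Real.pi * (t - γ))
  have h3 := Real.abs_sin_le_one (2 * Real.pi * γ)
  linarith

theorem hasDerivAt_trigKernel (γ t : ℝ) :
    HasDerivAt (trigKernel γ) (2 * Real.pi * Real.cos (2 * Real.pi * (t - γ))) t := by
  have h : HasDerivAt (fun t : ℝ => 2 * Real.pi * (t - γ)) (2 * Real.pi) t := by
    simpa using ((hasDerivAt_id t).sub_const γ).const_mul (2 * Real.pi)
  have := (h.sin).add_const (Real.sin (2 * Real.pi * γ))
  exact this.congr_deriv (mul_comm _ _)

theorem trigKernel_zero (γ : ℝ) : trigKernel γ 0 = 0 := by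
  simp [trigKernel, mul_neg, Real.sin_neg]

theorem intervalIntegral_cos_eq_trigKernel {x : ℝ} (hx : 0 < x) (γ s : ℝ) :
    ∫ t in (0 : ℝ)..s, Real.cos (2 * Real.pi * (x * t - γ))
      = (2 * Real.pi * x)⁻¹ * trigKernel γ (x * s) := by
  have hpi := Real.pi_pos
  have h : ∀ t ∈ uIcc 0 s, HasDerivAt (fun t => (2 * Real.pi * x)⁻¹ * trigKernel γ (x * t))
      (Real.cos (2 * Real.pi * (x * t - γ))) t := by
    intro t _
    have h1 : HasDerivAt (fun t : ℝ => x * t) x t := by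
      simpa using (hasDerivAt_id t).const_mul x
    have h2 := ((hasDerivAt_trigKernel γ (x * t)).comp t h1).const_mul (2 * Real.pi * x)⁻¹
    refine h2.congr_deriv ?_
    field_simp
  rw [intervalIntegral.integral_eq_sub_of_hasDerivAt h
    (Continuous.intervalIntegrable (by fun_prop) _ _)]
  simp [trigKernel_zero]

theorem setIntegral_Ioc_indicator_cos {x : ℝ} (hx : 0 < x) (γ : ℝ) {R s : ℝ} (hR : 0 < R)
    (hs : 0 < s) :
    ∫ t in Ioc 0 R, (Iio s).indicator (fun t => (Real.cos (2 * Real.pi * (x * t - γ)) : ℂ)) t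
      = (((2 * Real.pi * x)⁻¹ * trigKernel γ (x * min s R) : ℝ) : ℂ) := by
  rw [setIntegral_indicator measurableSet_Iio]
  have h1 : (Ioc 0 R ∩ Iio s : Set ℝ) =ᵐ[volume] Ioc 0 (min s R) := by
    have h2 : (Iio s : Set ℝ) =ᵐ[volume] Iic s := Iio_ae_eq_Iic
    have h3 : (Ioc 0 R ∩ Iio s : Set ℝ) =ᵐ[volume] (Ioc 0 R ∩ Iic s : Set ℝ) :=
      (ae_eq_refl _).inter h2
    rwa [Ioc_inter_Iic, min_comm] at h3
  rw [setIntegral_congr_set h1, integral_complex_ofReal,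
    ← intervalIntegral.integral_of_le (le_min hs.le hR.le),
    intervalIntegral_cos_eq_trigKernel hx]

theorem setIntegral_Ioi_eq_indicator {m : Measure ℝ} {θ : ℝ → ℂ} {t : ℝ} (ht : 0 < t) :
    ∫ s in Ioi t, θ s ∂m = ∫ s in Ioi 0, (Ioi t).indicator θ s ∂m := by
  rw [setIntegral_indicator measurableSet_Ioi,
    inter_eq_self_of_subset_right (Ioi_subset_Ioi ht.le)]

section Transform

variable {m : Measure ℝ} [IsFiniteMeasure m] {θ : ℝ → ℂ}

/-- The hypothesis of Fubini: on a bounded range of `t` the integrand is dominated by `‖θ(s)‖`.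
Truncation at `R` makes this possible. -/
theorem integrable_tail_mul_cos (hθm : Measurable θ) (hθ : Integrable θ m) (x γ R : ℝ) :
    Integrable (fun z : ℝ × ℝ => (Ioi z.1).indicator θ z.2 *
      (Real.cos (2 * Real.pi * (x * z.1 - γ)) : ℂ))
      ((volume.restrict (Ioc 0 R)).prod (m.restrict (Ioi 0))) := by
  have hm : Measurable (fun z : ℝ × ℝ => (Ioi z.1).indicator θ z.2 *
      (Real.cos (2 * Real.pi * (x * z.1 - γ)) : ℂ)) := by
    have h1 : (fun z : ℝ × ℝ => (Ioi z.1).indicator θ z.2)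
        = {z : ℝ × ℝ | z.1 < z.2}.indicator (fun z => θ z.2) := by
      ext z; simp [indicator]
    refine Measurable.mul ?_ (by fun_prop)
    rw [h1]
    exact (hθm.comp measurable_snd).indicator (measurableSet_lt measurable_fst measurable_snd)
  have hb : Integrable (fun z : ℝ × ℝ => ‖θ z.2‖)
      ((volume.restrict (Ioc 0 R)).prod (m.restrict (Ioi 0))) :=
    (hθ.norm.integrableOn (s := Ioi 0)).comp_snd (volume.restrict (Ioc 0 R))
  refine hb.mono' hm.aestronglyMeasurable (ae_of_all _ fun z => ?_)
  rw [norm_mul, Complex.norm_real]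
  calc _ ≤ ‖θ z.2‖ * 1 := by
        gcongr
        · exact norm_indicator_le_norm_self _ _
        · exact Real.abs_cos_le_one _
    _ = _ := mul_one _

/-- Insert the tail formula for `f` and integrate in `t` first, over `0 < t < min s R`. -/
theorem setIntegral_mul_cos_eq {f : ℝ → ℂ} (hθm : Measurable θ) (hθ : Integrable θ m)
    (hfθ : ∀ᵐ t : ℝ, 0 < t → f t = - ∫ s in Ioi t, θ s ∂m) {x : ℝ} (hx : 0 < x) (γ : ℝ)
    {R : ℝ} (hR : 0 < R) :
    IntegrableOn (fun t => f t * (Real.cos (2 * Real.pi * (x * t - γ)) : ℂ)) (Ioc 0 R) volume ∧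
    ∫ t in Ioc 0 R, f t * (Real.cos (2 * Real.pi * (x * t - γ)) : ℂ)
      = - ∫ s in Ioi 0, θ s * (((2 * Real.pi * x)⁻¹ * trigKernel γ (x * min s R) : ℝ) : ℂ) ∂m := by
  have hint := integrable_tail_mul_cos hθm hθ x γ R
  have hae : (fun t => f t * (Real.cos (2 * Real.pi * (x * t - γ)) : ℂ))
      =ᵐ[volume.restrict (Ioc 0 R)] fun t => - ∫ s in Ioi 0, (Ioi t).indicator θ s *
        (Real.cos (2 * Real.pi * (x * t - γ)) : ℂ) ∂m := by
    filter_upwards [ae_restrict_of_ae hfθ, ae_restrict_mem measurableSet_Ioc] with t h1 h2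
    rw [h1 h2.1, setIntegral_Ioi_eq_indicator h2.1, MeasureTheory.integral_mul_const, neg_mul]
  refine ⟨(hint.integral_prod_left.neg).congr hae.symm, ?_⟩
  rw [integral_congr_ae hae, MeasureTheory.integral_neg, integral_integral_swap hint]
  congr 1
  refine setIntegral_congr_fun measurableSet_Ioi fun s hs => ?_
  rw [← setIntegral_Ioc_indicator_cos hx γ hR hs, ← MeasureTheory.integral_const_mul]
  congr 1; ext t
  by_cases h : t < s <;> simp [h]

/-- The kernel is bounded uniformly in `R` and, for fixed `s`, is constant once `R ≥ s`; dominated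
convergence applies. -/
theorem tendsto_setIntegral_mul_cos {f : ℝ → ℂ} (hθm : Measurable θ) (hθ : Integrable θ m)
    (hfθ : ∀ᵐ t : ℝ, 0 < t → f t = - ∫ s in Ioi t, θ s ∂m) {x : ℝ} (hx : 0 < x) (γ : ℝ) :
    Tendsto (fun R : ℝ => ∫ t in Ioc 0 R, f t * (Real.cos (2 * Real.pi * (x * t - γ)) : ℂ))
      atTop (𝓝 (- ∫ s in Ioi 0, θ s * (((2 * Real.pi * x)⁻¹ * trigKernel γ (x * s) : ℝ) : ℂ) ∂m))
      := by
  have key : Tendsto (fun R : ℝ => - ∫ s in Ioi 0, θ s *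
      (((2 * Real.pi * x)⁻¹ * trigKernel γ (x * min s R) : ℝ) : ℂ) ∂m) atTop
      (𝓝 (- ∫ s in Ioi 0, θ s * (((2 * Real.pi * x)⁻¹ * trigKernel γ (x * s) : ℝ) : ℂ) ∂m)) := by
    refine Tendsto.neg (tendsto_integral_filter_of_dominated_convergence
      (fun s => ‖θ s‖ * (|(2 * Real.pi * x)⁻¹| * 2)) ?_ ?_ ?_ ?_)
    · refine Eventually.of_forall fun R => ?_
      have := continuous_trigKernel γ
      exact (hθm.mul (Continuous.measurable (by fun_prop))).aestronglyMeasurable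
    · refine Eventually.of_forall fun R => ae_of_all _ fun s => ?_
      rw [norm_mul, Complex.norm_real, Real.norm_eq_abs, abs_mul]
      gcongr
      exact abs_trigKernel_le_two _ _
    · exact (hθ.norm.mul_const _).integrableOn
    · refine ae_of_all _ fun s => ?_
      refine tendsto_const_nhds.congr' ?_
      filter_upwards [eventually_ge_atTop s] with R hR
      rw [min_eq_left hR]
  refine key.congr' ?_
  filter_upwards [eventually_gt_atTop 0] with R hR
  exact (setIntegral_mul_cos_eq hθm hθ hfθ hx γ hR).2.symm

end Transform

/-! ### The `L^p` weight and pairings with smooth functions -/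

/-- The smooth weight `(1 + x²)^{-1/2}`, which lies in `L^p(ℝ)` for every `p > 1`. -/
noncomputable def bracketInv (x : ℝ) : ℝ := (Real.sqrt (1 + x ^ 2))⁻¹

theorem bracketInv_pos (x : ℝ) : 0 < bracketInv x :=
  inv_pos.2 (Real.sqrt_pos.2 (by positivity))

theorem bracketInv_le_one (x : ℝ) : bracketInv x ≤ 1 := by
  unfold bracketInv
  refine inv_le_one_of_one_le₀ ?_
  rw [Real.one_le_sqrt]
  nlinarith [sq_nonneg x]

theorem contDiff_bracketInv {n : ℕ∞} : ContDiff ℝ n bracketInv := by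
  unfold bracketInv
  refine ContDiff.inv (ContDiff.sqrt (by fun_prop) fun x => by positivity) fun x => ?_
  exact (Real.sqrt_pos.2 (by positivity)).ne'

theorem continuous_bracketInv : Continuous bracketInv :=
  (contDiff_bracketInv (n := 0)).continuous

theorem one_le_one_add_abs_mul_bracketInv (x : ℝ) : 1 ≤ (1 + |x|) * bracketInv x := by
  unfold bracketInv
  rw [← div_eq_mul_inv, one_le_div (Real.sqrt_pos.2 (by positivity)), Real.sqrt_le_left (by positivity)]
  nlinarith [abs_nonneg x, sq_abs x]

/-- The place where `p > 1` enters: the weight decays only like `1/|x|`. -/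
theorem memLp_bracketInv {p : ℝ≥0∞} (hp : 1 < p) : MemLp bracketInv p volume := by
  rcases eq_or_ne p ∞ with rfl | htop
  · refine memLp_top_of_bound continuous_bracketInv.aestronglyMeasurable 1 (ae_of_all _ fun x => ?_)
    rw [Real.norm_of_nonneg (bracketInv_pos x).le]
    exact bracketInv_le_one x
  · rw [← integrable_norm_rpow_iff continuous_bracketInv.aestronglyMeasurable
      (zero_lt_one.trans hp).ne' htop]
    have h1 : 1 < p.toReal := by
      rw [← ENNReal.toReal_one]
      exact (ENNReal.toReal_lt_toReal ENNReal.one_ne_top htop).2 hp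
    have h2 : Integrable (fun x : ℝ => ((1 : ℝ) + ‖x‖ ^ 2) ^ (-p.toReal / 2)) volume :=
      integrable_rpow_neg_one_add_norm_sq (by simpa using h1)
    refine h2.congr (ae_of_all _ fun x => ?_)
    have h3 : (0 : ℝ) ≤ 1 + x ^ 2 := by positivity
    beta_reduce
    rw [Real.norm_of_nonneg (bracketInv_pos x).le, bracketInv, Real.norm_eq_abs, sq_abs,
      Real.sqrt_eq_rpow, ← Real.rpow_neg h3, ← Real.rpow_mul h3]
    congr 1
    ring

/-- A positive real bound for the `L^p` norm of `bracketInv`. -/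
noncomputable def bracketBound (p : ℝ≥0∞) : ℝ := (eLpNorm bracketInv p volume).toReal + 1

theorem bracketBound_pos (p : ℝ≥0∞) : 0 < bracketBound p := by
  unfold bracketBound; positivity

/-- Dilation by `u` costs `u^{-1/p}` and the amplitude gives `u`. -/
theorem eLpNorm_bracketInv_comp_mul_le {p : ℝ≥0∞} (hp : 1 < p) {u : ℝ} (hu : 0 < u) :
    eLpNorm (fun ξ => u * bracketInv (u * ξ)) p volume
      ≤ ENNReal.ofReal (u ^ (1 - (p⁻¹).toReal) * bracketBound p) := by
  have h1 : eLpNorm (bracketInv ∘ (u * ·)) p volume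
      = ENNReal.ofReal (u ^ (-(p⁻¹).toReal)) * eLpNorm bracketInv p volume := by
    rw [← eLpNorm_map_measure continuous_bracketInv.aestronglyMeasurable (by fun_prop),
      Real.map_volume_mul_left hu.ne', eLpNorm_smul_measure_of_ne_zero
        (by simpa using hu.ne'), abs_of_pos (inv_pos.2 hu), smul_eq_mul, one_div,
      ENNReal.ofReal_rpow_of_pos (inv_pos.2 hu), Real.inv_rpow hu.le, Real.rpow_neg hu.le]
  have h2 : (fun ξ => u * bracketInv (u * ξ)) = u • (bracketInv ∘ (u * ·)) := by
    ext ξ; simp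
  rw [h2, eLpNorm_const_smul, h1, ← ofReal_norm, Real.norm_of_nonneg hu.le, ← mul_assoc,
    ← ENNReal.ofReal_mul hu.le]
  have h3 : u * u ^ (-(p⁻¹).toReal) = u ^ (1 - (p⁻¹).toReal) := by
    rw [sub_eq_add_neg, Real.rpow_add hu, Real.rpow_one]
  rw [h3, ENNReal.ofReal_mul (by positivity)]
  gcongr
  unfold bracketBound
  rw [ENNReal.le_ofReal_iff_toReal_le (memLp_bracketInv hp).2.ne (by positivity)]
  linarith

/-- The `L¹` norm of `h` bounds the transform by `Du`, and that of `h'` bounds it by `D/|ξ|`; the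
weight combines the two. -/
theorem norm_fourier_le_bracketInv {h : ℝ → ℂ} (hs : HasCompactSupport h) (hd : ContDiff ℝ 1 h)
    {u D : ℝ} (hu : 0 < u) (h0 : ∫ t, ‖h t‖ ≤ D * u) (h1 : ∫ t, ‖deriv h t‖ ≤ D) (ξ : ℝ) :
    ‖𝓕 h ξ‖ ≤ 2 * D * (u * bracketInv (u * ξ)) := by
  have hi : Integrable h := hd.continuous.integrable_of_hasCompactSupport hs
  have hdc : Continuous (deriv h) := hd.continuous_deriv le_rfl
  have hi' : Integrable (deriv h) := hdc.integrable_of_hasCompactSupport hs.deriv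
  have hle : ∀ g : ℝ → ℂ, ‖𝓕 g ξ‖ ≤ ∫ t, ‖g t‖ := fun g =>
    VectorFourier.norm_fourierIntegral_le_integral_norm 𝐞 volume (innerₗ ℝ) g ξ
  have b0 := (hle h).trans h0
  have b1 := (hle (deriv h)).trans h1
  rw [Real.fourier_deriv hi (hd.differentiable one_ne_zero) hi', norm_smul] at b1
  have e1 : ‖(2 * Real.pi * Complex.I * ξ : ℂ)‖ = 2 * Real.pi * |ξ| := by
    simp [abs_of_pos Real.pi_pos]
  rw [e1] at b1
  have hN := norm_nonneg (𝓕 h ξ)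
  have hpi : 1 ≤ 2 * Real.pi := by linarith [Real.pi_gt_three]
  have b2 : |ξ| * ‖𝓕 h ξ‖ ≤ D := by
    refine le_trans ?_ b1
    rw [mul_assoc (2 * Real.pi)]
    exact le_mul_of_one_le_left (by positivity) hpi
  have b3 : ‖𝓕 h ξ‖ * (1 + |u * ξ|) ≤ 2 * D * u := by
    rw [abs_mul, abs_of_pos hu]
    nlinarith
  have b4 := one_le_one_add_abs_mul_bracketInv (u * ξ)
  have b5 := bracketInv_pos (u * ξ)
  calc ‖𝓕 h ξ‖ ≤ ‖𝓕 h ξ‖ * ((1 + |u * ξ|) * bracketInv (u * ξ)) :=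
        le_mul_of_one_le_right hN b4
    _ = ‖𝓕 h ξ‖ * (1 + |u * ξ|) * bracketInv (u * ξ) := by ring
    _ ≤ 2 * D * u * bracketInv (u * ξ) := by gcongr
    _ = _ := by ring

/-- The pairing of a measure with a smooth function, bounded by its `L¹` norm and its variation. -/
theorem enorm_integral_mul_le_of_smooth {p : ℝ≥0∞} (hp : 1 < p) {m : Measure ℝ} {θ : ℝ → ℂ}
    (hθ : Integrable θ m) {h : ℝ → ℂ} (hs : HasCompactSupport h) (hd : ContDiff ℝ (⊤ : ℕ∞) h)
    {u D : ℝ} (hu : 0 < u) (hD : 0 < D) (h0 : ∫ t, ‖h t‖ ≤ D * u)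
    (h1 : ∫ t, ‖deriv h t‖ ≤ D) :
    ‖∫ t, h t * θ t ∂m‖ₑ ≤ ENNReal.ofReal (2 * D * (u ^ (1 - (p⁻¹).toReal) * bracketBound p)) *
      starNorm p (m.withDensityᵥ θ) := by
  have hW := bracketBound_pos p
  refine enorm_integral_mul_le_starNorm hθ p (hs.toSchwartzMap hd) (by positivity) ?_
  change eLpNorm (𝓕 h) p volume ≤ _
  have h2 : eLpNorm (𝓕 h) p volume
      ≤ eLpNorm ((2 * D) • fun ξ => u * bracketInv (u * ξ)) p volume := by
    refine eLpNorm_mono_real fun ξ => ?_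
    exact norm_fourier_le_bracketInv hs (hd.of_le (by simp)) hu h0 h1 ξ
  refine h2.trans ?_
  rw [eLpNorm_const_smul, ← ofReal_norm, Real.norm_of_nonneg (by positivity),
    ENNReal.ofReal_mul (p := 2 * D) (by positivity)]
  gcongr
  exact eLpNorm_bracketInv_comp_mul_le hp hu

/-! ### Smooth cut-offs and pairings on one octave -/

theorem abs_trigKernel_le (γ t : ℝ) : |trigKernel γ t| ≤ 2 * Real.pi * |t| := by
  have h := (convex_univ (𝕜 := ℝ) (E := ℝ)).norm_image_sub_le_of_norm_hasDerivWithin_le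
    (f := trigKernel γ) (C := 2 * Real.pi)
    (fun s _ => (hasDerivAt_trigKernel γ s).hasDerivWithinAt) (fun s _ => ?_)
    (mem_univ (0 : ℝ)) (mem_univ t)
  · simpa [trigKernel_zero] using h
  · rw [norm_mul, Real.norm_of_nonneg (by positivity)]
    exact mul_le_of_le_one_right (by positivity) (Real.abs_cos_le_one _)

theorem contDiff_trigKernel (γ : ℝ) {n : ℕ∞} : ContDiff ℝ n (trigKernel γ) := by
  unfold trigKernel
  have h : ContDiff ℝ n Real.sin := Real.contDiff_sin
  exact (h.comp (by fun_prop)).add contDiff_const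

/-- A smooth bump function equal to `1` on `[1, 2]`. -/
noncomputable def octaveBump : ContDiffBump (3 / 2 : ℝ) := ⟨1 / 2, 1, by norm_num, by norm_num⟩

theorem octaveBump_eq_one {t : ℝ} (h1 : 1 ≤ t) (h2 : t ≤ 2) : octaveBump t = 1 := by
  refine octaveBump.one_of_mem_closedBall ?_
  rw [Metric.mem_closedBall, Real.dist_eq, abs_le]
  change -(1 / 2) ≤ _ ∧ _ ≤ (1 / 2 : ℝ)
  constructor <;> linarith

/-- Steepening a step leaves its variation unchanged, which makes the later bounds uniform in `n`.
-/
theorem integral_comp_mul_sub (g : ℝ → ℝ) {n : ℝ} (hn : 0 < n) (y : ℝ) :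
    ∫ s, n * g (n * (s - y)) = ∫ s, g s := by
  rw [MeasureTheory.integral_const_mul, integral_sub_right_eq_self (fun s => g (n * s)) y,
    Measure.integral_comp_mul_left, abs_of_pos (inv_pos.2 hn), smul_eq_mul,
    mul_inv_cancel_left₀ hn.ne']

theorem hasCompactSupport_deriv_smoothTransition :
    HasCompactSupport (deriv Real.smoothTransition) := by
  refine HasCompactSupport.of_support_subset_isCompact (isCompact_Icc (a := (0 : ℝ)) (b := 1)) ?_
  intro x hx
  by_contra hxI
  apply hx
  rcases lt_or_ge x 0 with h | h
  · have : Real.smoothTransition =ᶠ[𝓝 x] fun _ => 0 := by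
      filter_upwards [eventually_lt_nhds h] with z hz
      exact Real.smoothTransition.zero_of_nonpos hz.le
    rw [this.deriv_eq, deriv_const]
  · have h1 : 1 < x := by
      by_contra h2
      exact hxI ⟨h, not_lt.1 h2⟩
    have : Real.smoothTransition =ᶠ[𝓝 x] fun _ => 1 := by
      filter_upwards [eventually_gt_nhds h1] with z hz
      exact Real.smoothTransition.one_of_one_le hz.le
    rw [this.deriv_eq, deriv_const]

theorem integrable_deriv_smoothTransition : Integrable (deriv Real.smoothTransition) := by
  have h : ContDiff ℝ 1 Real.smoothTransition := Real.smoothTransition.contDiff (n := 1)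
  exact (h.continuous_deriv le_rfl).integrable_of_hasCompactSupport
    hasCompactSupport_deriv_smoothTransition

theorem continuous_deriv_octaveBump : Continuous (deriv octaveBump) :=
  (octaveBump.contDiff (n := 1)).continuous_deriv le_rfl

/-- A constant dominating the integrals of the cut-off functions that occur below. -/
noncomputable def cutoffConst : ℝ :=
  (∫ t, |octaveBump t|) + (∫ t, |t * octaveBump t|) + (∫ t, |deriv octaveBump t|) +
    (∫ t, |t * deriv octaveBump t|) + (∫ t, |deriv Real.smoothTransition t|) + 1

theorem cutoffConst_pos : 0 < cutoffConst := by
  unfold cutoffConst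
  have h1 : 0 ≤ ∫ t, |octaveBump t| := integral_nonneg fun _ => abs_nonneg _
  have h2 : 0 ≤ ∫ t, |t * octaveBump t| := integral_nonneg fun _ => abs_nonneg _
  have h3 : 0 ≤ ∫ t, |deriv octaveBump t| := integral_nonneg fun _ => abs_nonneg _
  have h4 : 0 ≤ ∫ t, |t * deriv octaveBump t| := integral_nonneg fun _ => abs_nonneg _
  have h5 : 0 ≤ ∫ t, |deriv Real.smoothTransition t| := integral_nonneg fun _ => abs_nonneg _
  linarith

section Smooth

variable {p : ℝ≥0∞} {m : Measure ℝ} {θ : ℝ → ℂ} {u : ℝ}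

theorem enorm_integral_ofReal_mul_le {g g' : ℝ → ℝ} (hp : 1 < p)
    (hθ : Integrable θ m) (hs : HasCompactSupport g) (hd : ContDiff ℝ (⊤ : ℕ∞) g)
    (hg : ∀ s, HasDerivAt g (g' s) s)
    {D : ℝ} (hu : 0 < u) (hD : 0 < D) (h0 : ∫ t, |g t| ≤ D * u) (h1 : ∫ t, |g' t| ≤ D) :
    ‖∫ t, (g t : ℂ) * θ t ∂m‖ₑ ≤
      ENNReal.ofReal (2 * D * (u ^ (1 - (p⁻¹).toReal) * bracketBound p)) *
      starNorm p (m.withDensityᵥ θ) := by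
  refine enorm_integral_mul_le_of_smooth hp hθ (h := fun t => (g t : ℂ))
    (hs.comp_left Complex.ofReal_zero) (Complex.ofRealCLM.contDiff.comp hd) hu hD ?_ ?_
  · simpa using h0
  · have h2 : ∀ t, deriv (fun t => (g t : ℂ)) t = (g' t : ℂ) := fun t => (hg t).ofReal_comp.deriv
    simp_rw [h2]
    simpa using h1

theorem hasCompactSupport_octaveBump_div (hu : 0 < u) :
    HasCompactSupport fun s => octaveBump (s / u) := by
  have h := octaveBump.hasCompactSupport.comp_smul (inv_ne_zero hu.ne')
  simpa [div_eq_inv_mul] using h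

theorem hasDerivAt_octaveBump_div (u s : ℝ) :
    HasDerivAt (fun s => octaveBump (s / u)) (deriv octaveBump (s / u) / u) s := by
  have h1 : HasDerivAt (fun s : ℝ => s / u) (1 / u) s := (hasDerivAt_id s).div_const u
  have h2 : HasDerivAt octaveBump (deriv octaveBump (s / u)) (s / u) :=
    ((octaveBump.contDiff (n := 1)).differentiable one_ne_zero _).hasDerivAt
  have h3 := h2.comp s h1
  rw [mul_one_div] at h3
  exact h3

theorem contDiff_octaveBump_div {n : ℕ∞} : ContDiff ℝ n fun s => octaveBump (s / u) :=
  octaveBump.contDiff.comp (by fun_prop)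

theorem integral_abs_comp_div (g : ℝ → ℝ) (hu : 0 < u) :
    ∫ s, |g (s / u)| = (∫ s, |g s|) * u := by
  rw [Measure.integral_comp_div (fun s => |g s|), abs_of_pos hu, smul_eq_mul, mul_comm]

/-- The kernel vanishes at `0`, so after localisation its size and variation are `O(xu)`; this
factor `x` will cancel `1/x`. -/
theorem enorm_integral_trigKernel_le (hp : 1 < p) (hθ : Integrable θ m) (hu : 0 < u)
    (hm : ∀ᵐ s ∂m, s ∈ Ioo u (2 * u)) {x : ℝ} (hx : 0 < x) (γ : ℝ) :
    ‖∫ s, (trigKernel γ (x * s) : ℂ) * θ s ∂m‖ₑ ≤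
      ENNReal.ofReal (2 * (2 * Real.pi * x * u * cutoffConst) *
        (u ^ (1 - (p⁻¹).toReal) * bracketBound p)) * starNorm p (m.withDensityᵥ θ) := by
  have hpi := Real.pi_pos
  have hB := cutoffConst_pos
  have e : ∫ s, (trigKernel γ (x * s) : ℂ) * θ s ∂m
      = ∫ s, ((trigKernel γ (x * s) * octaveBump (s / u) : ℝ) : ℂ) * θ s ∂m := by
    refine integral_congr_ae ?_
    filter_upwards [hm] with s hs
    rw [octaveBump_eq_one ((one_le_div hu).2 hs.1.le) ((div_le_iff₀ hu).2 hs.2.le), mul_one]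
  have i1 : Integrable fun s => |octaveBump (s / u)| :=
    (octaveBump.integrable.comp_div hu.ne').abs
  have c2 : Integrable fun s => s * octaveBump s :=
    (continuous_id.mul octaveBump.continuous).integrable_of_hasCompactSupport
      octaveBump.hasCompactSupport.mul_left
  have i2 : Integrable fun s => |s / u * octaveBump (s / u)| := (c2.comp_div hu.ne').abs
  have c3 : Integrable fun s => s * deriv octaveBump s :=
    (continuous_id.mul continuous_deriv_octaveBump).integrable_of_hasCompactSupport
      octaveBump.hasCompactSupport.deriv.mul_left
  have i3 : Integrable fun s => |s / u * deriv octaveBump (s / u)| := (c3.comp_div hu.ne').abs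
  have h1 : 0 ≤ ∫ t, |octaveBump t| := integral_nonneg fun _ => abs_nonneg _
  have h2 : 0 ≤ ∫ t, |t * octaveBump t| := integral_nonneg fun _ => abs_nonneg _
  have h3 : 0 ≤ ∫ t, |deriv octaveBump t| := integral_nonneg fun _ => abs_nonneg _
  have h4 : 0 ≤ ∫ t, |t * deriv octaveBump t| := integral_nonneg fun _ => abs_nonneg _
  have h5 : 0 ≤ ∫ t, |deriv Real.smoothTransition t| := integral_nonneg fun _ => abs_nonneg _
  have b1 : (∫ t, |t * octaveBump t|) ≤ cutoffConst := by unfold cutoffConst; linarith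
  have b2 : (∫ t, |octaveBump t|) + (∫ t, |t * deriv octaveBump t|) ≤ cutoffConst := by
    unfold cutoffConst; linarith
  have hK : ∀ s, |trigKernel γ (x * s)| ≤ 2 * Real.pi * x * u * |s / u| := by
    intro s
    refine (abs_trigKernel_le γ (x * s)).trans (le_of_eq ?_)
    rw [abs_mul, abs_div, abs_of_pos hx, abs_of_pos hu]
    field_simp
  rw [e]
  refine enorm_integral_ofReal_mul_le hp hθ
    (g := fun s => trigKernel γ (x * s) * octaveBump (s / u))
    (g' := fun s => 2 * Real.pi * Real.cos (2 * Real.pi * (x * s - γ)) * x * octaveBump (s / u) +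
      trigKernel γ (x * s) * (deriv octaveBump (s / u) / u))
    (hasCompactSupport_octaveBump_div hu).mul_left
    (((contDiff_trigKernel γ).comp (by fun_prop)).mul contDiff_octaveBump_div) ?_ hu
    (by positivity) ?_ ?_
  · intro s
    have k1 : HasDerivAt (fun s : ℝ => x * s) x s := by
      simpa using (hasDerivAt_id s).const_mul x
    exact ((hasDerivAt_trigKernel γ (x * s)).comp s k1).mul (hasDerivAt_octaveBump_div u s)
  · calc ∫ s, |trigKernel γ (x * s) * octaveBump (s / u)|
        ≤ ∫ s, 2 * Real.pi * x * u * |s / u * octaveBump (s / u)| := by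
          refine integral_mono_of_nonneg (ae_of_all _ fun _ => abs_nonneg _) (i2.const_mul _)
            (ae_of_all _ fun s => ?_)
          beta_reduce
          rw [abs_mul, abs_mul, ← mul_assoc]
          gcongr
          exact hK s
      _ = 2 * Real.pi * x * u * (∫ t, |t * octaveBump t|) * u := by
          rw [MeasureTheory.integral_const_mul,
            integral_abs_comp_div (fun t => t * octaveBump t) hu]
          ring
      _ ≤ _ := by gcongr
  · calc ∫ s, |2 * Real.pi * Real.cos (2 * Real.pi * (x * s - γ)) * x * octaveBump (s / u) +
          trigKernel γ (x * s) * (deriv octaveBump (s / u) / u)|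
        ≤ ∫ s, (2 * Real.pi * x * |octaveBump (s / u)| +
            2 * Real.pi * x * |s / u * deriv octaveBump (s / u)|) := by
          refine integral_mono_of_nonneg (ae_of_all _ fun _ => abs_nonneg _)
            ((i1.const_mul _).add (i3.const_mul _)) (ae_of_all _ fun s => ?_)
          refine (abs_add_le _ _).trans (add_le_add ?_ ?_)
          · rw [abs_mul, abs_mul, abs_of_pos hx]
            refine mul_le_mul_of_nonneg_right (mul_le_mul_of_nonneg_right ?_ hx.le) (abs_nonneg _)
            rw [abs_mul, abs_of_pos (by positivity : 0 < 2 * Real.pi)]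
            exact mul_le_of_le_one_right (by positivity) (Real.abs_cos_le_one _)
          · rw [abs_mul, abs_div, abs_of_pos hu]
            calc _ ≤ 2 * Real.pi * x * u * |s / u| * (|deriv octaveBump (s / u)| / u) := by
                  gcongr
                  exact hK s
              _ = _ := by
                  rw [abs_mul]
                  field_simp
      _ = 2 * Real.pi * x * u * ((∫ t, |octaveBump t|) + ∫ t, |t * deriv octaveBump t|) := by
          rw [MeasureTheory.integral_add (i1.const_mul _) (i3.const_mul _),
            MeasureTheory.integral_const_mul, MeasureTheory.integral_const_mul,
            integral_abs_comp_div _ hu,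
            integral_abs_comp_div (fun t => t * deriv octaveBump t) hu]
          ring
      _ ≤ _ := by gcongr

/-- A localised step has size and variation bounded independently of its steepness `n` and position
`y`. -/
theorem enorm_integral_smoothTransition_le (hp : 1 < p) (hθ : Integrable θ m) (hu : 0 < u)
    (hm : ∀ᵐ s ∂m, s ∈ Ioo u (2 * u)) (y : ℝ) {n : ℝ} (hn : 0 < n) :
    ‖∫ s, (Real.smoothTransition (n * (s - y)) : ℂ) * θ s ∂m‖ₑ ≤
      ENNReal.ofReal (2 * cutoffConst *
        (u ^ (1 - (p⁻¹).toReal) * bracketBound p)) * starNorm p (m.withDensityᵥ θ) := by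
  have hB := cutoffConst_pos
  have e : ∫ s, (Real.smoothTransition (n * (s - y)) : ℂ) * θ s ∂m
      = ∫ s, ((Real.smoothTransition (n * (s - y)) * octaveBump (s / u) : ℝ) : ℂ) * θ s ∂m := by
    refine integral_congr_ae ?_
    filter_upwards [hm] with s hs
    rw [octaveBump_eq_one ((one_le_div hu).2 hs.1.le) ((div_le_iff₀ hu).2 hs.2.le), mul_one]
  have i1 : Integrable fun s => |octaveBump (s / u)| :=
    (octaveBump.integrable.comp_div hu.ne').abs
  have c3 : Integrable (deriv octaveBump) :=
    continuous_deriv_octaveBump.integrable_of_hasCompactSupport octaveBump.hasCompactSupport.deriv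
  have i3 : Integrable fun s => |deriv octaveBump (s / u)| := (c3.comp_div hu.ne').abs
  have i4 : Integrable fun s => n * |deriv Real.smoothTransition (n * (s - y))| :=
    (((integrable_deriv_smoothTransition.abs).comp_mul_left' hn.ne').comp_sub_right y).const_mul n
  have h1 : 0 ≤ ∫ t, |octaveBump t| := integral_nonneg fun _ => abs_nonneg _
  have h2 : 0 ≤ ∫ t, |t * octaveBump t| := integral_nonneg fun _ => abs_nonneg _
  have h3 : 0 ≤ ∫ t, |deriv octaveBump t| := integral_nonneg fun _ => abs_nonneg _
  have h4 : 0 ≤ ∫ t, |t * deriv octaveBump t| := integral_nonneg fun _ => abs_nonneg _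
  have h5 : 0 ≤ ∫ t, |deriv Real.smoothTransition t| := integral_nonneg fun _ => abs_nonneg _
  have b1 : (∫ t, |octaveBump t|) ≤ cutoffConst := by unfold cutoffConst; linarith
  have hS : ContDiff ℝ (⊤ : ℕ∞) Real.smoothTransition := Real.smoothTransition.contDiff
  have hS1 : ∀ s, |Real.smoothTransition s| ≤ 1 := fun s => by
    rw [abs_of_nonneg (Real.smoothTransition.nonneg s)]
    exact Real.smoothTransition.le_one s
  rw [e]
  refine enorm_integral_ofReal_mul_le hp hθ
    (g := fun s => Real.smoothTransition (n * (s - y)) * octaveBump (s / u))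
    (g' := fun s => deriv Real.smoothTransition (n * (s - y)) * n * octaveBump (s / u) +
      Real.smoothTransition (n * (s - y)) * (deriv octaveBump (s / u) / u))
    (hasCompactSupport_octaveBump_div hu).mul_left
    ((hS.comp (by fun_prop)).mul contDiff_octaveBump_div) ?_ hu
    (by positivity) ?_ ?_
  · intro s
    have k1 : HasDerivAt (fun s : ℝ => n * (s - y)) n s := by
      simpa using ((hasDerivAt_id s).sub_const y).const_mul n
    have k2 : HasDerivAt Real.smoothTransition _ (n * (s - y)) :=
      (hS.differentiable (by simp) _).hasDerivAt
    exact (k2.comp s k1).mul (hasDerivAt_octaveBump_div u s)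
  · calc ∫ s, |Real.smoothTransition (n * (s - y)) * octaveBump (s / u)|
        ≤ ∫ s, |octaveBump (s / u)| := by
          refine integral_mono_of_nonneg (ae_of_all _ fun _ => abs_nonneg _) i1
            (ae_of_all _ fun s => ?_)
          beta_reduce
          rw [abs_mul]
          exact mul_le_of_le_one_left (abs_nonneg _) (hS1 _)
      _ = (∫ t, |octaveBump t|) * u := integral_abs_comp_div _ hu
      _ ≤ _ := by gcongr
  · calc ∫ s, |deriv Real.smoothTransition (n * (s - y)) * n * octaveBump (s / u) +
          Real.smoothTransition (n * (s - y)) * (deriv octaveBump (s / u) / u)|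
        ≤ ∫ s, (n * |deriv Real.smoothTransition (n * (s - y))| +
            |deriv octaveBump (s / u)| / u) := by
          refine integral_mono_of_nonneg (ae_of_all _ fun _ => abs_nonneg _)
            (i4.add (i3.div_const u)) (ae_of_all _ fun s => ?_)
          refine (abs_add_le _ _).trans (add_le_add ?_ ?_)
          · rw [abs_mul, abs_mul, abs_of_pos hn, abs_of_nonneg octaveBump.nonneg,
              mul_comm n (|_|)]
            exact mul_le_of_le_one_right (by positivity) octaveBump.le_one
          · rw [abs_mul, abs_div, abs_of_pos hu]
            exact mul_le_of_le_one_left (by positivity) (hS1 _)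
      _ = (∫ t, |deriv Real.smoothTransition t|) + ∫ t, |deriv octaveBump t| := by
          rw [MeasureTheory.integral_add i4 (i3.div_const u),
            integral_comp_mul_sub (fun s => |deriv Real.smoothTransition s|) hn,
            MeasureTheory.integral_div, integral_abs_comp_div _ hu, mul_div_cancel_right₀ _ hu.ne']
      _ ≤ _ := by unfold cutoffConst; linarith

/-- Let `n → ∞` in the bound for smooth steps. They converge at every point, including `0` at `s =
y`, so atoms do no harm. -/
theorem enorm_setIntegral_Ioi_le (hp : 1 < p) (hθ : Integrable θ m) (hu : 0 < u)
    (hm : ∀ᵐ s ∂m, s ∈ Ioo u (2 * u)) (y : ℝ) :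
    ‖∫ s in Ioi y, θ s ∂m‖ₑ ≤
      ENNReal.ofReal (2 * cutoffConst *
        (u ^ (1 - (p⁻¹).toReal) * bracketBound p)) * starNorm p (m.withDensityᵥ θ) := by
  have hlim : Tendsto (fun n : ℕ => ∫ s, (Real.smoothTransition ((n + 1 : ℝ) * (s - y)) : ℂ) *
      θ s ∂m) atTop (𝓝 (∫ s in Ioi y, θ s ∂m)) := by
    rw [← MeasureTheory.integral_indicator measurableSet_Ioi]
    have hc : Continuous Real.smoothTransition := Real.smoothTransition.continuous
    refine tendsto_integral_of_dominated_convergence (fun s => ‖θ s‖) (fun n => ?_) hθ.norm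
      (fun n => ae_of_all _ fun s => ?_) (ae_of_all _ fun s => ?_)
    · exact (Continuous.aestronglyMeasurable (by fun_prop)).mul hθ.1
    · rw [norm_mul, Complex.norm_real,
        Real.norm_of_nonneg (Real.smoothTransition.nonneg _)]
      exact mul_le_of_le_one_left (norm_nonneg _) (Real.smoothTransition.le_one _)
    · by_cases hs : y < s
      · rw [indicator_of_mem (show s ∈ Ioi y from hs)]
        refine tendsto_const_nhds.congr' ?_
        obtain ⟨N, hN⟩ := exists_nat_ge (1 / (s - y))
        filter_upwards [eventually_ge_atTop N] with n hn
        have h1 : (N : ℝ) ≤ n := by exact_mod_cast hn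
        have h0 : 0 < s - y := sub_pos.2 hs
        rw [div_le_iff₀ h0] at hN
        rw [Real.smoothTransition.one_of_one_le (by nlinarith), Complex.ofReal_one, one_mul]
      · rw [indicator_of_notMem (show s ∉ Ioi y from hs)]
        refine tendsto_const_nhds.congr fun n => ?_
        have h0 : s - y ≤ 0 := sub_nonpos.2 (not_lt.1 hs)
        rw [Real.smoothTransition.zero_of_nonpos
          (mul_nonpos_of_nonneg_of_nonpos (by positivity) h0), Complex.ofReal_zero, zero_mul]
  refine le_of_tendsto hlim.enorm (Eventually.of_forall fun n => ?_)
  exact enorm_integral_smoothTransition_le hp hθ hu hm y (by positivity)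

end Smooth

/-! ### Duality for the Fourier transform of a measure on an octave -/

section CharInt

/-- The conjugate Fourier transform `∫ e^{2πisx} θ(s) dm(s)` of the complex measure `θ dm`. -/
noncomputable def charInt (m : Measure ℝ) (θ : ℝ → ℂ) (x : ℝ) : ℂ :=
  ∫ s, (Real.fourierChar (s * x) : ℂ) * θ s ∂m

variable {p : ℝ≥0∞} {m : Measure ℝ} {θ : ℝ → ℂ} {u : ℝ}

/-- Bounded support gives finite moments of all orders. Smoothness lets test functions be built from
the transform itself. -/
theorem contDiff_charInt (hθ : Integrable θ m) (hm : ∀ᵐ s ∂m, s ∈ Ioo u (2 * u)) :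
    ContDiff ℝ (⊤ : ℕ∞) (charInt m θ) := by
  have h := VectorFourier.contDiff_fourierIntegral (μ := m) (f := θ) (N := ⊤)
    (-(ContinuousLinearMap.mul ℝ ℝ)) (fun n _ => ?_)
  · have e : charInt m θ = VectorFourier.fourierIntegral 𝐞 m
        (-(ContinuousLinearMap.mul ℝ ℝ)).toLinearMap₁₂ θ := by
      funext x
      unfold charInt VectorFourier.fourierIntegral
      congr 1; ext s
      simp [Circle.smul_def]
    rw [e]
    exact h
  · refine Integrable.bdd_mul (c := |2 * u| ^ n) hθ.norm
      (Continuous.aestronglyMeasurable (by fun_prop)) ?_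
    filter_upwards [hm] with s hs
    have h0 : 0 < u := by linarith [hs.1, hs.2]
    rw [norm_pow, norm_norm, Real.norm_of_nonneg (h0.trans hs.1).le,
      abs_of_pos (by linarith : 0 < 2 * u)]
    have := hs.2.le
    have := (h0.trans hs.1).le
    gcongr

theorem integral_fourierInv_mul_eq [IsFiniteMeasure m] (hθ : Integrable θ m) {g : ℝ → ℂ}
    (hg : Integrable g) :
    ∫ s, 𝓕⁻ g s * θ s ∂m = ∫ x, g x * charInt m θ x := by
  have hint : Integrable (fun z : ℝ × ℝ => (Real.fourierChar (z.1 * z.2) : ℂ) * (g z.2 * θ z.1))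
      (m.prod volume) := by
    have h1 : Integrable (fun z : ℝ × ℝ => θ z.1 * g z.2) (m.prod volume) := hθ.mul_prod hg
    refine Integrable.bdd_mul (c := 1) (h1.congr (ae_of_all _ fun z => mul_comm _ _))
      (Continuous.aestronglyMeasurable ?_) (ae_of_all _ fun z => (Circle.norm_coe _).le)
    exact continuous_subtype_val.comp (Real.continuous_fourierChar.comp (by fun_prop))
  have e1 : ∀ s, 𝓕⁻ g s * θ s
      = ∫ x, (Real.fourierChar (s * x) : ℂ) * (g x * θ s) := by
    intro s
    rw [Real.fourierInv_eq, ← MeasureTheory.integral_mul_const]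
    congr 1; ext x
    simp [Circle.smul_def, mul_assoc, mul_comm]
  have e2 : ∀ x, g x * charInt m θ x
      = ∫ s, (Real.fourierChar (s * x) : ℂ) * (g x * θ s) ∂m := by
    intro x
    rw [charInt, ← MeasureTheory.integral_const_mul]
    congr 1; ext s
    ring
  simp_rw [e1, e2]
  exact integral_integral_swap hint

/-- Test the measure against `h = 𝓕⁻ g`: then `ĥ = g`, so the star norm asks only for `‖g‖_p`, which
the weight bounds. -/
theorem enorm_integral_mul_charInt_le [IsFiniteMeasure m] (hp : 1 < p) (hθ : Integrable θ m)
    (hu : 0 < u) {g : ℝ → ℂ} (hs : HasCompactSupport g) (hd : ContDiff ℝ (⊤ : ℕ∞) g)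
    (hg : ∀ x, ‖g x‖ ≤ u * bracketInv (u * x)) :
    ‖∫ x, g x * charInt m θ x‖ₑ ≤ ENNReal.ofReal (u ^ (1 - (p⁻¹).toReal) * bracketBound p) *
      starNorm p (m.withDensityᵥ θ) := by
  have hW := bracketBound_pos p
  set G : 𝓢(ℝ, ℂ) := hs.toSchwartzMap hd with hG
  have hGi : Integrable g := G.integrable
  rw [← integral_fourierInv_mul_eq hθ hGi]
  have e0 : (𝓕⁻ g : ℝ → ℂ) = ((𝓕⁻ G : 𝓢(ℝ, ℂ)) : ℝ → ℂ) := by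
    rw [SchwartzMap.fourierInv_coe]; rfl
  rw [e0]
  refine enorm_integral_mul_le_starNorm hθ p (𝓕⁻ G) (by positivity) ?_
  have e : 𝓕 ((𝓕⁻ G : 𝓢(ℝ, ℂ)) : ℝ → ℂ) = g := by
    rw [← SchwartzMap.fourier_coe, FourierTransform.fourier_fourierInv_eq G]; rfl
  change eLpNorm (𝓕 ((𝓕⁻ G : 𝓢(ℝ, ℂ)) : ℝ → ℂ)) p volume ≤ _
  rw [e]
  exact (eLpNorm_mono_real hg).trans (eLpNorm_bracketInv_comp_mul_le hp hu)

theorem sq_div_sqrt_tendsto {a : ℝ} (ha : 0 ≤ a) :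
    Tendsto (fun n : ℕ => a ^ 2 / Real.sqrt (a ^ 2 + 1 / (n + 1 : ℝ))) atTop (𝓝 a) := by
  rcases ha.eq_or_lt with rfl | h
  · simp
  · have h1 : Tendsto (fun n : ℕ => Real.sqrt (a ^ 2 + 1 / (n + 1 : ℝ))) atTop
        (𝓝 (Real.sqrt (a ^ 2 + 0))) :=
      (Real.continuous_sqrt.tendsto _).comp
        (tendsto_const_nhds.add tendsto_one_div_add_atTop_nhds_zero_nat)
    rw [add_zero, Real.sqrt_sq h.le] at h1
    have h2 := (tendsto_const_nhds (x := a ^ 2)).div h1 h.ne'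
    rw [show a ^ 2 / a = a by field_simp] at h2
    exact h2

/-- The extremal choice is `g = w · conj φ / |φ|`, with `w` the weight. It is made smooth and
compactly supported, and Fatou removes the regularisation. -/
theorem lintegral_charInt_le [IsFiniteMeasure m] (hp : 1 < p) (hθ : Integrable θ m)
    (hu : 0 < u) (hm : ∀ᵐ s ∂m, s ∈ Ioo u (2 * u)) :
    ∫⁻ x, ENNReal.ofReal (u * bracketInv (u * x)) * ‖charInt m θ x‖ₑ ≤
      ENNReal.ofReal (u ^ (1 - (p⁻¹).toReal) * bracketBound p) *
      starNorm p (m.withDensityᵥ θ) := by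
  set φ := charInt m θ with hφ
  have hφd : ContDiff ℝ (⊤ : ℕ∞) φ := contDiff_charInt hθ hm
  have hw : ∀ x, 0 < u * bracketInv (u * x) := fun x => mul_pos hu (bracketInv_pos _)
  let χ : ℕ → ContDiffBump (0 : ℝ) := fun n => ⟨n + 1, n + 2, by positivity, by linarith⟩
  -- A smooth positive majorant of `|φ|`, so that dividing by it is harmless at the zeros of `φ`.
  let q : ℕ → ℝ → ℝ := fun n x => Real.sqrt (‖φ x‖ ^ 2 + 1 / (n + 1 : ℝ))
  have hq : ∀ n x, 0 < q n x := fun n x => Real.sqrt_pos.2 (by positivity)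
  have hφq : ∀ n x, ‖φ x‖ ≤ q n x := fun n x =>
    Real.le_sqrt_of_sq_le (le_add_of_nonneg_right (by positivity))
  have hqd : ∀ n, ContDiff ℝ (⊤ : ℕ∞) (q n) := fun n =>
    ((hφd.norm_sq ℝ).add contDiff_const).sqrt fun x => by positivity
  let r : ℕ → ℝ → ℝ := fun n x => χ n x * (u * bracketInv (u * x)) * (q n x)⁻¹
  have hr0 : ∀ n x, 0 ≤ r n x := fun n x =>
    mul_nonneg (mul_nonneg (χ n).nonneg (hw x).le) (inv_nonneg.2 (hq n x).le)
  have hrd : ∀ n, ContDiff ℝ (⊤ : ℕ∞) (r n) := fun n =>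
    ((χ n).contDiff.mul (contDiff_const.mul (contDiff_bracketInv.comp (by fun_prop)))).mul
      ((hqd n).inv fun x => (hq n x).ne')
  have hrs : ∀ n, HasCompactSupport (r n) := fun n =>
    ((χ n).hasCompactSupport.mul_right).mul_right
  let g : ℕ → ℝ → ℂ := fun n x => (r n x : ℂ) * (starRingEnd ℂ) (φ x)
  have hgs : ∀ n, HasCompactSupport (g n) := fun n =>
    ((hrs n).comp_left Complex.ofReal_zero).mul_right
  have hgd : ∀ n, ContDiff ℝ (⊤ : ℕ∞) (g n) := fun n =>
    (Complex.ofRealCLM.contDiff.comp (hrd n)).mul (Complex.conjCLE.contDiff.comp hφd)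
  have hgb : ∀ n x, ‖g n x‖ ≤ u * bracketInv (u * x) := by
    intro n x
    rw [norm_mul, Complex.norm_real, RCLike.norm_conj, Real.norm_of_nonneg (hr0 n x)]
    have h1 : (q n x)⁻¹ * ‖φ x‖ ≤ 1 := by
      rw [inv_mul_le_iff₀ (hq n x), mul_one]
      exact hφq n x
    calc r n x * ‖φ x‖ = χ n x * (u * bracketInv (u * x)) * ((q n x)⁻¹ * ‖φ x‖) := by
          simp only [r]; ring
      _ ≤ 1 * (u * bracketInv (u * x)) * 1 := by
          have := (hw x).le
          gcongr
          exact (χ n).le_one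
      _ = _ := by ring
  have hgφ : ∀ n x, g n x * φ x = ((r n x * ‖φ x‖ ^ 2 : ℝ) : ℂ) := by
    intro n x
    simp only [g]
    rw [mul_assoc, Complex.conj_mul']
    push_cast
    ring
  have hfc : ∀ n, Continuous fun x => r n x * ‖φ x‖ ^ 2 := fun n =>
    (hrd n).continuous.mul (hφd.continuous.norm.pow 2)
  have key : ∀ n, ∫⁻ x, ENNReal.ofReal (r n x * ‖φ x‖ ^ 2) ≤
      ENNReal.ofReal (u ^ (1 - (p⁻¹).toReal) * bracketBound p) *
      starNorm p (m.withDensityᵥ θ) := by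
    intro n
    have hi : Integrable fun x => r n x * ‖φ x‖ ^ 2 :=
      (hfc n).integrable_of_hasCompactSupport (hrs n).mul_right
    have h0 : ∀ x, 0 ≤ r n x * ‖φ x‖ ^ 2 := fun x => mul_nonneg (hr0 n x) (by positivity)
    rw [← ofReal_integral_eq_lintegral_ofReal hi (ae_of_all _ h0)]
    refine le_trans (le_of_eq ?_) (enorm_integral_mul_charInt_le hp hθ hu (hgs n) (hgd n) (hgb n))
    rw [← hφ]
    simp_rw [hgφ]
    rw [integral_complex_ofReal, ← ofReal_norm, Complex.norm_real,
      Real.norm_of_nonneg (integral_nonneg h0)]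
  have hlim : ∀ x, Tendsto (fun n => ENNReal.ofReal (r n x * ‖φ x‖ ^ 2)) atTop
      (𝓝 (ENNReal.ofReal (u * bracketInv (u * x)) * ‖φ x‖ₑ)) := by
    intro x
    rw [← ofReal_norm, ← ENNReal.ofReal_mul (hw x).le]
    refine (ENNReal.continuous_ofReal.tendsto _).comp ?_
    refine ((sq_div_sqrt_tendsto (norm_nonneg (φ x))).const_mul (u * bracketInv (u * x))).congr' ?_
    obtain ⟨N, hN⟩ := exists_nat_ge |x|
    filter_upwards [eventually_ge_atTop N] with n hn
    have h1 : χ n x = 1 := by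
      refine (χ n).one_of_mem_closedBall ?_
      rw [mem_closedBall_zero_iff, Real.norm_eq_abs]
      have : (N : ℝ) ≤ n := by exact_mod_cast hn
      change |x| ≤ (n : ℝ) + 1
      linarith
    simp only [r, q, h1]
    ring
  calc ∫⁻ x, ENNReal.ofReal (u * bracketInv (u * x)) * ‖φ x‖ₑ
      = ∫⁻ x, liminf (fun n => ENNReal.ofReal (r n x * ‖φ x‖ ^ 2)) atTop := by
        congr 1; ext x
        exact (hlim x).liminf_eq.symm
    _ ≤ liminf (fun n => ∫⁻ x, ENNReal.ofReal (r n x * ‖φ x‖ ^ 2)) atTop :=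
        lintegral_liminf_le fun n => (hfc n).measurable.ennreal_ofReal
    _ ≤ _ := by
        refine (liminf_le_liminf (Eventually.of_forall key)).trans ?_
        simp

end CharInt

/-! ### The remainder on one octave -/

/-- The kernel of the remainder: `sin 2π(xs - γ) + sin 2πγ · 1_{xs ≤ 1}`. -/
noncomputable def remainderKernel (γ x s : ℝ) : ℝ :=
  trigKernel γ (x * s) - Real.sin (2 * Real.pi * γ) * (Ioi (1 / x)).indicator 1 s

theorem measurable_remainderKernel (γ : ℝ) :
    Measurable fun z : ℝ × ℝ => remainderKernel γ z.1 z.2 := by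
  have h1 : (fun z : ℝ × ℝ => (Ioi (1 / z.1)).indicator (1 : ℝ → ℝ) z.2)
      = {z : ℝ × ℝ | 1 / z.1 < z.2}.indicator 1 := by
    ext z; simp [indicator]
  have h2 : Measurable fun z : ℝ × ℝ => (Ioi (1 / z.1)).indicator (1 : ℝ → ℝ) z.2 := by
    rw [h1]
    exact measurable_one.indicator
      (measurableSet_lt (measurable_fst.const_div 1) measurable_snd)
  unfold remainderKernel
  have h3 := (continuous_trigKernel γ).measurable
  exact (h3.comp (by fun_prop)).sub (h2.const_mul _)

theorem abs_remainderKernel_le (γ x s : ℝ) : |remainderKernel γ x s| ≤ 3 := by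
  unfold remainderKernel
  refine (abs_sub _ _).trans ?_
  have h1 := abs_trigKernel_le_two γ (x * s)
  have h2 : |Real.sin (2 * Real.pi * γ) * (Ioi (1 / x)).indicator (1 : ℝ → ℝ) s| ≤ 1 * 1 := by
    rw [abs_mul]
    gcongr
    · exact Real.abs_sin_le_one _
    · by_cases h : s ∈ Ioi (1 / x)
      · rw [indicator_of_mem h, Pi.one_apply, abs_one]
      · rw [indicator_of_notMem h, abs_zero]; exact zero_le_one
  linarith

section Octave

variable {p : ℝ≥0∞} {m : Measure ℝ} {θ : ℝ → ℂ} {u : ℝ}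

theorem integrable_remainderKernel_mul (hθ : Integrable θ m) (γ x : ℝ) :
    Integrable (fun s => (remainderKernel γ x s : ℂ) * θ s) m := by
  have h : Measurable fun s => (remainderKernel γ x s : ℂ) :=
    Complex.measurable_ofReal.comp
      (Measurable.of_uncurry_left (f := remainderKernel γ) (measurable_remainderKernel γ))
  refine Integrable.bdd_mul (c := 3) hθ h.aestronglyMeasurable (ae_of_all _ fun s => ?_)
  rw [Complex.norm_real]
  exact abs_remainderKernel_le γ x s

theorem integral_remainderKernel_mul (hθ : Integrable θ m) (γ x : ℝ) :
    ∫ s, (remainderKernel γ x s : ℂ) * θ s ∂m = (∫ s, (trigKernel γ (x * s) : ℂ) * θ s ∂m) -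
      (Real.sin (2 * Real.pi * γ) : ℂ) * ∫ s in Ioi (1 / x), θ s ∂m := by
  have h1 : Integrable (fun s => (trigKernel γ (x * s) : ℂ) * θ s) m := by
    have hc := continuous_trigKernel γ
    refine hθ.bdd_mul (c := 2) (Continuous.aestronglyMeasurable (by fun_prop))
      (ae_of_all _ fun s => ?_)
    rw [Complex.norm_real]
    exact abs_trigKernel_le_two γ _
  rw [← MeasureTheory.integral_indicator measurableSet_Ioi,
    ← MeasureTheory.integral_const_mul, ← MeasureTheory.integral_sub h1
      ((hθ.indicator measurableSet_Ioi).const_mul _)]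
  congr 1; ext s
  unfold remainderKernel
  by_cases h : s ∈ Ioi (1 / x)
  · simp only [indicator_of_mem h, Pi.one_apply]; push_cast; ring
  · simp only [indicator_of_notMem h]; push_cast; ring

/-- Euler's formula: the phase `γ` contributes only unimodular factors. -/
theorem norm_integral_sin_mul_le (hθ : Integrable θ m) (γ x : ℝ) :
    ‖∫ s, (Real.sin (2 * Real.pi * (x * s - γ)) : ℂ) * θ s ∂m‖ ≤
      ‖charInt m θ x‖ + ‖charInt m θ (-x)‖ := by
  have hi : ∀ y : ℝ, Integrable (fun s => (Real.fourierChar (s * y) : ℂ) * θ s) m := by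
    intro y
    refine hθ.bdd_mul (c := 1) (Continuous.aestronglyMeasurable ?_)
      (ae_of_all _ fun s => (Circle.norm_coe _).le)
    exact continuous_subtype_val.comp (Real.continuous_fourierChar.comp (by fun_prop))
  have e : ∫ s, (Real.sin (2 * Real.pi * (x * s - γ)) : ℂ) * θ s ∂m
      = (Real.fourierChar γ : ℂ) * (Complex.I / 2) * charInt m θ (-x) -
        (Real.fourierChar (-γ) : ℂ) * (Complex.I / 2) * charInt m θ x := by
    unfold charInt
    rw [← MeasureTheory.integral_const_mul, ← MeasureTheory.integral_const_mul,
      ← MeasureTheory.integral_sub ((hi _).const_mul _) ((hi _).const_mul _)]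
    congr 1; ext s
    have e1 : (Real.fourierChar γ : ℂ) * (Real.fourierChar (s * -x) : ℂ)
        = Complex.exp (-((2 * Real.pi * (x * s - γ) : ℝ) : ℂ) * Complex.I) := by
      rw [Real.fourierChar_apply, Real.fourierChar_apply, ← Complex.exp_add]
      congr 1; push_cast; ring
    have e2 : (Real.fourierChar (-γ) : ℂ) * (Real.fourierChar (s * x) : ℂ)
        = Complex.exp (((2 * Real.pi * (x * s - γ) : ℝ) : ℂ) * Complex.I) := by
      rw [Real.fourierChar_apply, Real.fourierChar_apply, ← Complex.exp_add]
      congr 1; push_cast; ring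
    rw [Complex.ofReal_sin, Complex.sin, ← e1, ← e2]
    ring
  rw [e]
  refine (norm_sub_le _ _).trans ?_
  have hc : ‖Complex.I / 2‖ ≤ 1 := by
    rw [norm_div, Complex.norm_I, Complex.norm_two]; norm_num
  rw [norm_mul, norm_mul, norm_mul, norm_mul, Circle.norm_coe, Circle.norm_coe, one_mul, add_comm]
  exact add_le_add (mul_le_of_le_one_left (norm_nonneg _) hc)
    (mul_le_of_le_one_left (norm_nonneg _) hc)

/-- With `v = ux > 1` one has `√(1+v²) ≤ 2v ≤ 2πv`. -/
theorem inv_le_bracketInv {x : ℝ} (hu : 0 < u) (hx : 1 / u < x) :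
    (2 * Real.pi * x)⁻¹ ≤ u * bracketInv (u * x) := by
  have h0 : 0 < x := (one_div_pos.2 hu).trans hx
  have h1 : 1 < u * x := by
    rw [div_lt_iff₀ hu] at hx; linarith
  have h2 : Real.sqrt (1 + (u * x) ^ 2) ≤ 2 * Real.pi * x * u := by
    rw [Real.sqrt_le_left (by positivity)]
    have h3 : (2 * (u * x)) ^ 2 ≤ (2 * Real.pi * x * u) ^ 2 := by
      have : 1 ≤ Real.pi := by linarith [Real.pi_gt_three]
      have h4 : u * x * 1 ≤ u * x * Real.pi := by gcongr
      exact pow_le_pow_left₀ (by positivity) (by linarith) 2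
    nlinarith
  unfold bracketInv
  have h5 : 0 < Real.sqrt (1 + (u * x) ^ 2) := Real.sqrt_pos.2 (by positivity)
  rw [← div_eq_mul_inv, le_div_iff₀ h5, inv_mul_le_iff₀ (by positivity)]
  exact h2

/-- The two parts of the kernel are treated separately. The half-line misses the octave unless `1/x
< 2u`, and then `1/x` costs at most a multiple of `u`. -/
theorem enorm_remainder_low_le (hp : 1 < p) (hθ : Integrable θ m)
    (hu : 0 < u) (hm : ∀ᵐ s ∂m, s ∈ Ioo u (2 * u)) (γ : ℝ) {x : ℝ} (hx : 0 < x) :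
    ENNReal.ofReal (2 * Real.pi * x)⁻¹ * ‖∫ s, (remainderKernel γ x s : ℂ) * θ s ∂m‖ₑ ≤
      ENNReal.ofReal (4 * u * cutoffConst * (u ^ (1 - (p⁻¹).toReal) * bracketBound p)) *
        starNorm p (m.withDensityᵥ θ) := by
  have hpi := Real.pi_pos
  have hB := cutoffConst_pos
  have hW := bracketBound_pos p
  set E := u ^ (1 - (p⁻¹).toReal) * bracketBound p with hE
  have hE0 : 0 < E := by positivity
  set N := starNorm p (m.withDensityᵥ θ)
  have h1 : ENNReal.ofReal (2 * Real.pi * x)⁻¹ * ‖∫ s, (trigKernel γ (x * s) : ℂ) * θ s ∂m‖ₑ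
      ≤ ENNReal.ofReal (2 * u * cutoffConst * E) * N := by
    refine (mul_le_mul_right (enorm_integral_trigKernel_le hp hθ hu hm hx γ) _).trans (le_of_eq ?_)
    rw [← mul_assoc, ← ENNReal.ofReal_mul (by positivity)]
    congr 2
    rw [← hE]
    field_simp
  have h2 : ENNReal.ofReal (2 * Real.pi * x)⁻¹ * ‖∫ s in Ioi (1 / x), θ s ∂m‖ₑ
      ≤ ENNReal.ofReal (2 * u * cutoffConst * E) * N := by
    by_cases h : 2 * u ≤ 1 / x
    · have h3 : ∫ s in Ioi (1 / x), θ s ∂m = 0 := by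
        rw [← MeasureTheory.integral_indicator measurableSet_Ioi]
        refine integral_eq_zero_of_ae ?_
        filter_upwards [hm] with s hs
        exact indicator_of_notMem (fun h4 => not_lt.2 h (lt_trans h4 hs.2)) _
      rw [h3, enorm_zero, mul_zero]
      exact zero_le
    · have h4 : (2 * Real.pi * x)⁻¹ ≤ u := by
        rw [inv_le_iff_one_le_mul₀ (by positivity)]
        have h5 : 1 < 2 * u * x := by
          rw [not_le, div_lt_iff₀ hx] at h; linarith
        have h6 : 2 * u * x * 1 ≤ 2 * u * x * Real.pi := by
          gcongr; linarith [Real.pi_gt_three]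
        linarith
      refine (mul_le_mul' (ENNReal.ofReal_le_ofReal h4)
        (enorm_setIntegral_Ioi_le hp hθ hu hm (1 / x))).trans (le_of_eq ?_)
      rw [← mul_assoc, ← ENNReal.ofReal_mul (by positivity)]
      congr 2
      rw [← hE]
      ring
  rw [integral_remainderKernel_mul hθ]
  calc _ ≤ ENNReal.ofReal (2 * Real.pi * x)⁻¹ *
        (‖∫ s, (trigKernel γ (x * s) : ℂ) * θ s ∂m‖ₑ + ‖∫ s in Ioi (1 / x), θ s ∂m‖ₑ) := by
        gcongr
        refine enorm_sub_le.trans ?_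
        gcongr
        rw [enorm_mul]
        refine mul_le_of_le_one_left' ?_
        rw [← ofReal_norm, Complex.norm_real]
        exact ENNReal.ofReal_le_one.2 (Real.abs_sin_le_one _)
    _ ≤ ENNReal.ofReal (2 * u * cutoffConst * E) * N +
        ENNReal.ofReal (2 * u * cutoffConst * E) * N := by
        rw [mul_add]; exact add_le_add h1 h2
    _ = _ := by
        rw [← add_mul, ← ENNReal.ofReal_add (by positivity) (by positivity)]
        congr 2; ring

/-- Now `1/x < u`, so the octave lies beyond the cut `s = 1/x`, the two constants `sin 2πγ` cancel
and a pure wave is left. -/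
theorem enorm_remainder_high_le (hθ : Integrable θ m)
    (hu : 0 < u) (hm : ∀ᵐ s ∂m, s ∈ Ioo u (2 * u)) (γ : ℝ) {x : ℝ} (hxu : 1 / u < x) :
    ENNReal.ofReal (2 * Real.pi * x)⁻¹ * ‖∫ s, (remainderKernel γ x s : ℂ) * θ s ∂m‖ₑ ≤
      ENNReal.ofReal (u * bracketInv (u * x)) * ‖charInt m θ x‖ₑ +
      ENNReal.ofReal (u * bracketInv (u * x)) * ‖charInt m θ (-x)‖ₑ := by
  have h0 : 0 < x := (one_div_pos.2 hu).trans hxu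
  have e : ∫ s, (remainderKernel γ x s : ℂ) * θ s ∂m
      = ∫ s, (Real.sin (2 * Real.pi * (x * s - γ)) : ℂ) * θ s ∂m := by
    refine integral_congr_ae ?_
    filter_upwards [hm] with s hs
    have h1 : s ∈ Ioi (1 / x) := by
      rw [div_lt_iff₀ hu] at hxu
      rw [mem_Ioi, div_lt_iff₀ h0]
      nlinarith [hs.1]
    congr 2
    unfold remainderKernel trigKernel
    rw [indicator_of_mem h1]
    simp
  rw [e, ← mul_add]
  refine mul_le_mul' (ENNReal.ofReal_le_ofReal (inv_le_bracketInv hu hxu)) ?_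
  rw [← ofReal_norm, ← ofReal_norm, ← ofReal_norm,
    ← ENNReal.ofReal_add (norm_nonneg _) (norm_nonneg _)]
  exact ENNReal.ofReal_le_ofReal (norm_integral_sin_mul_le hθ γ x)

/-- The estimate of the remainder for a measure supported in one octave. -/
theorem lintegral_remainder_octave_le [IsFiniteMeasure m] (hp : 1 < p) (hθ : Integrable θ m)
    (hu : 0 < u) (hm : ∀ᵐ s ∂m, s ∈ Ioo u (2 * u)) (γ : ℝ) :
    ∫⁻ x in Ioi 0, ENNReal.ofReal (2 * Real.pi * x)⁻¹ *
        ‖∫ s, (remainderKernel γ x s : ℂ) * θ s ∂m‖ₑ ≤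
      ENNReal.ofReal ((4 * cutoffConst + 2) * (u ^ (1 - (p⁻¹).toReal) * bracketBound p)) *
        starNorm p (m.withDensityᵥ θ) := by
  have hB := cutoffConst_pos
  have hW := bracketBound_pos p
  have hhigh := lintegral_charInt_le hp hθ hu hm
  have hlow := fun (x : ℝ) (hx : 0 < x) =>
    enorm_remainder_low_le hp hθ hu hm γ hx
  set E := u ^ (1 - (p⁻¹).toReal) * bracketBound p with hE
  have hE0 : 0 < E := by positivity
  set N := starNorm p (m.withDensityᵥ θ)
  have hφ : Continuous (charInt m θ) := (contDiff_charInt hθ hm).continuous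
  have hbr : Measurable fun x => ENNReal.ofReal (u * bracketInv (u * x)) := by
    have := continuous_bracketInv
    exact (Continuous.measurable (by fun_prop)).ennreal_ofReal
  have m1 : Measurable fun x => ENNReal.ofReal (u * bracketInv (u * x)) * ‖charInt m θ x‖ₑ :=
    hbr.mul hφ.measurable.enorm
  have m2 : Measurable fun x => ENNReal.ofReal (u * bracketInv (u * x)) * ‖charInt m θ (-x)‖ₑ :=
    hbr.mul (hφ.comp continuous_neg).measurable.enorm
  have hneg : ∫⁻ x, ENNReal.ofReal (u * bracketInv (u * x)) * ‖charInt m θ (-x)‖ₑ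
      ≤ ENNReal.ofReal E * N := by
    rw [← lintegral_neg_eq_self]
    refine le_trans (le_of_eq ?_) hhigh
    congr 1; ext x
    rw [neg_neg]
    congr 3
    simp [bracketInv]
  calc _ ≤ ∫⁻ x in Ioi 0, ((Ioc 0 (1 / u)).indicator
            (fun _ => ENNReal.ofReal (4 * u * cutoffConst * E) * N) x +
          ENNReal.ofReal (u * bracketInv (u * x)) * ‖charInt m θ x‖ₑ +
          ENNReal.ofReal (u * bracketInv (u * x)) * ‖charInt m θ (-x)‖ₑ) := by
        refine setLIntegral_mono' measurableSet_Ioi fun x hx => ?_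
        rcases le_or_gt x (1 / u) with h | h
        · rw [indicator_of_mem (show x ∈ Ioc 0 (1 / u) from ⟨hx, h⟩), add_assoc]
          exact (hlow x hx).trans le_self_add
        · rw [add_assoc]
          exact (enorm_remainder_high_le hθ hu hm γ h).trans le_add_self
    _ ≤ ∫⁻ x, ((Ioc 0 (1 / u)).indicator
            (fun _ => ENNReal.ofReal (4 * u * cutoffConst * E) * N) x +
          ENNReal.ofReal (u * bracketInv (u * x)) * ‖charInt m θ x‖ₑ +
          ENNReal.ofReal (u * bracketInv (u * x)) * ‖charInt m θ (-x)‖ₑ) :=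
        setLIntegral_le_lintegral _ _
    -- The length `1/u` of the low range cancels the factor `u` of the low bound.
    _ = ENNReal.ofReal (4 * u * cutoffConst * E) * N * ENNReal.ofReal (1 / u) +
          (∫⁻ x, ENNReal.ofReal (u * bracketInv (u * x)) * ‖charInt m θ x‖ₑ) +
          ∫⁻ x, ENNReal.ofReal (u * bracketInv (u * x)) * ‖charInt m θ (-x)‖ₑ := by
        rw [lintegral_add_right _ m2, lintegral_add_right _ m1,
          lintegral_indicator_const measurableSet_Ioc, Real.volume_Ioc, sub_zero]
    _ ≤ ENNReal.ofReal (4 * cutoffConst * E) * N + ENNReal.ofReal E * N + ENNReal.ofReal E * N := by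
        refine add_le_add (add_le_add (le_of_eq ?_) hhigh) hneg
        rw [mul_right_comm, ← ENNReal.ofReal_mul (by positivity)]
        congr 2
        field_simp
    _ = _ := by
        rw [← add_mul, ← add_mul, ← ENNReal.ofReal_add (by positivity) hE0.le,
          ← ENNReal.ofReal_add (by positivity) hE0.le]
        congr 2; ring

end Octave

/-! ### Averaging over octaves -/

section Averaging

variable {m : Measure ℝ} [IsFiniteMeasure m]

theorem integral_inv_octave {s : ℝ} (hs : 0 < s) :
    ∫ u in Ioi 0, (Ioo (s / 2) s).indicator (fun u : ℝ => u⁻¹) u = Real.log 2 := by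
  have h0 : s / 2 ≤ s := by linarith
  rw [setIntegral_indicator measurableSet_Ioo,
    inter_eq_self_of_subset_right (Ioo_subset_Ioi_self.trans (Ioi_subset_Ioi (half_pos hs).le)),
    ← integral_Ioc_eq_integral_Ioo, ← intervalIntegral.integral_of_le h0,
    integral_inv_of_pos (half_pos hs) hs]
  congr 1
  field_simp

theorem integrable_inv_octave {s : ℝ} (hs : 0 < s) :
    Integrable ((Ioo (s / 2) s).indicator (fun u : ℝ => u⁻¹)) (volume.restrict (Ioi 0)) := by
  refine Integrable.integrableOn ?_
  rw [integrable_indicator_iff measurableSet_Ioo]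
  have h : IntegrableOn (fun u : ℝ => u⁻¹) (Icc (s / 2) s) := by
    refine ContinuousOn.integrableOn_Icc (continuousOn_inv₀.mono fun u hu => ?_)
    exact ((half_pos hs).trans_le hu.1).ne'
  exact h.mono_set Ioo_subset_Icc_self

/-- Averaging over the octaves `(u, 2u)` with respect to `du / u`. -/
theorem log_two_mul_setIntegral_Ioi {q : ℝ → ℂ} (hqm : Measurable q) (hq : Integrable q m) :
    (Real.log 2 : ℂ) * ∫ s in Ioi 0, q s ∂m
      = ∫ u in Ioi (0 : ℝ), ((u⁻¹ : ℝ) : ℂ) * ∫ s in Ioo u (2 * u), q s ∂m := by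
  have hset : MeasurableSet {z : ℝ × ℝ | z.1 < z.2 ∧ z.2 < 2 * z.1} :=
    (measurableSet_lt measurable_fst measurable_snd).inter
      (measurableSet_lt measurable_snd (measurable_fst.const_mul 2))
  set H : ℝ × ℝ → ℂ := {z : ℝ × ℝ | z.1 < z.2 ∧ z.2 < 2 * z.1}.indicator
    fun z => ((z.1⁻¹ : ℝ) : ℂ) * q z.2 with hH
  have hHm : Measurable H :=
    Measurable.indicator (by fun_prop) hset
  -- `s ∈ (u, 2u)` means `u ∈ (s/2, s)`; this form serves the integral in `u`, the next one the
  -- integral in `s`.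
  have hH1 : ∀ u s, H (u, s)
      = (((Ioo (s / 2) s).indicator (fun u : ℝ => u⁻¹) u : ℝ) : ℂ) * q s := by
    intro u s
    by_cases h : u < s ∧ s < 2 * u
    · rw [hH, indicator_of_mem (show (u, s) ∈ {z : ℝ × ℝ | z.1 < z.2 ∧ z.2 < 2 * z.1} from h),
        indicator_of_mem (show u ∈ Ioo (s / 2) s from ⟨by linarith [h.2], h.1⟩)]
    · rw [hH, indicator_of_notMem
          (show (u, s) ∉ {z : ℝ × ℝ | z.1 < z.2 ∧ z.2 < 2 * z.1} from h),
        indicator_of_notMem (fun h' : u ∈ Ioo (s / 2) s => h ⟨h'.2, by linarith [h'.1]⟩),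
        Complex.ofReal_zero, zero_mul]
  have hH2 : ∀ u s, H (u, s)
      = ((u⁻¹ : ℝ) : ℂ) * (Ioo u (2 * u)).indicator q s := by
    intro u s
    by_cases h : u < s ∧ s < 2 * u
    · rw [hH, indicator_of_mem (show (u, s) ∈ {z : ℝ × ℝ | z.1 < z.2 ∧ z.2 < 2 * z.1} from h),
        indicator_of_mem (show s ∈ Ioo u (2 * u) from h)]
    · rw [hH, indicator_of_notMem
          (show (u, s) ∉ {z : ℝ × ℝ | z.1 < z.2 ∧ z.2 < 2 * z.1} from h),
        indicator_of_notMem (show s ∉ Ioo u (2 * u) from h), mul_zero]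
  have hnn : ∀ s u : ℝ, 0 < s → 0 ≤ (Ioo (s / 2) s).indicator (fun u : ℝ => u⁻¹) u :=
    fun s u hs => indicator_nonneg (fun u hu => inv_nonneg.2 ((half_pos hs).trans hu.1).le) u
  have hint : Integrable H ((volume.restrict (Ioi 0)).prod (m.restrict (Ioi 0))) := by
    rw [integrable_prod_iff' hHm.aestronglyMeasurable]
    constructor
    · filter_upwards [ae_restrict_mem measurableSet_Ioi] with s hs
      simp_rw [hH1]
      exact (integrable_inv_octave hs).ofReal.mul_const _
    · have h1 : Integrable (fun s => Real.log 2 * ‖q s‖) (m.restrict (Ioi 0)) :=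
        (hq.norm.const_mul _).integrableOn
      refine h1.congr ?_
      filter_upwards [ae_restrict_mem measurableSet_Ioi] with s hs
      rw [← integral_inv_octave hs, ← MeasureTheory.integral_mul_const]
      congr 1; ext u
      rw [hH1, norm_mul, Complex.norm_real, Real.norm_of_nonneg (hnn s u hs)]
  have hswap := integral_integral_swap (f := fun u s => H (u, s)) hint
  have e1 : ∀ u, ∫ s in Ioi 0, H (u, s) ∂m
      = ((u⁻¹ : ℝ) : ℂ) * ∫ s in Ioi 0 ∩ Ioo u (2 * u), q s ∂m := by
    intro u
    simp_rw [hH2]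
    rw [MeasureTheory.integral_const_mul, setIntegral_indicator measurableSet_Ioo]
  have e2 : ∀ s ∈ Ioi (0 : ℝ), ∫ u in Ioi 0, H (u, s) = (Real.log 2 : ℂ) * q s := by
    intro s hs
    simp_rw [hH1]
    rw [MeasureTheory.integral_mul_const, integral_complex_ofReal, integral_inv_octave hs]
  rw [setIntegral_congr_fun measurableSet_Ioi e2, MeasureTheory.integral_const_mul] at hswap
  rw [← hswap]
  refine setIntegral_congr_fun measurableSet_Ioi fun u hu => ?_
  rw [e1, inter_eq_self_of_subset_right (Ioo_subset_Ioi_self.trans (Ioi_subset_Ioi (le_of_lt hu)))]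

theorem enorm_setIntegral_Ioi_le_lintegral_octave {q : ℝ → ℂ} (hqm : Measurable q)
    (hq : Integrable q m) :
    ‖∫ s in Ioi 0, q s ∂m‖ₑ ≤ ENNReal.ofReal (Real.log 2)⁻¹ *
      ∫⁻ u in Ioi (0 : ℝ), ENNReal.ofReal u⁻¹ * ‖∫ s in Ioo u (2 * u), q s ∂m‖ₑ := by
  have hl : 0 < Real.log 2 := Real.log_pos one_lt_two
  have h1 : ∫ s in Ioi 0, q s ∂m = (((Real.log 2)⁻¹ : ℝ) : ℂ) *
      ∫ u in Ioi (0 : ℝ), ((u⁻¹ : ℝ) : ℂ) * ∫ s in Ioo u (2 * u), q s ∂m := by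
    rw [← log_two_mul_setIntegral_Ioi hqm hq, ← mul_assoc, ← Complex.ofReal_mul,
      inv_mul_cancel₀ hl.ne', Complex.ofReal_one, one_mul]
  rw [h1, enorm_mul, ← ofReal_norm, Complex.norm_real, Real.norm_of_nonneg (by positivity)]
  gcongr
  refine (enorm_integral_le_lintegral_enorm _).trans (setLIntegral_mono' measurableSet_Ioi ?_)
  intro u hu
  rw [enorm_mul, ← ofReal_norm ((u⁻¹ : ℝ) : ℂ), Complex.norm_real,
    Real.norm_of_nonneg (inv_nonneg.2 (le_of_lt hu))]

end Averaging

/-! ### Assembling the octaves -/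

/-- Joint measurability in `x` and `u`, needed for Tonelli. The moving domain becomes an indicator
in three variables. -/
theorem measurable_setIntegral_remainderKernel {m : Measure ℝ} [IsFiniteMeasure m] {θ : ℝ → ℂ}
    (hθm : Measurable θ) (γ : ℝ) :
    Measurable fun z : ℝ × ℝ =>
      ∫ s in Ioo z.2 (2 * z.2), (remainderKernel γ z.1 s : ℂ) * θ s ∂m := by
  have hset : MeasurableSet {z : (ℝ × ℝ) × ℝ | z.1.2 < z.2 ∧ z.2 < 2 * z.1.2} :=
    (measurableSet_lt (measurable_snd.comp measurable_fst) measurable_snd).inter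
      (measurableSet_lt measurable_snd ((measurable_snd.comp measurable_fst).const_mul 2))
  have hK : Measurable fun z : (ℝ × ℝ) × ℝ => (remainderKernel γ z.1.1 z.2 : ℂ) :=
    Complex.measurable_ofReal.comp ((measurable_remainderKernel γ).comp
      (g := fun z : ℝ × ℝ => remainderKernel γ z.1 z.2)
      (f := fun z : (ℝ × ℝ) × ℝ => (z.1.1, z.2))
      ((measurable_fst.comp measurable_fst).prodMk measurable_snd))
  have h1 : Measurable ({z : (ℝ × ℝ) × ℝ | z.1.2 < z.2 ∧ z.2 < 2 * z.1.2}.indicator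
      fun z => (remainderKernel γ z.1.1 z.2 : ℂ) * θ z.2) :=
    (hK.mul (hθm.comp measurable_snd)).indicator hset
  have h2 := (h1.stronglyMeasurable.integral_prod_right' (ν := m)).measurable
  refine (congrArg Measurable (funext fun z => ?_)).mp h2
  rw [← MeasureTheory.integral_indicator measurableSet_Ioo]
  refine integral_congr_ae (ae_of_all _ fun s => ?_)
  by_cases h : z.2 < s ∧ s < 2 * z.2
  · rw [indicator_of_mem (show s ∈ Ioo z.2 (2 * z.2) from h)]
    exact indicator_of_mem
      (show (z, s) ∈ {z : (ℝ × ℝ) × ℝ | z.1.2 < z.2 ∧ z.2 < 2 * z.1.2} from h) _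
  · rw [indicator_of_notMem (show s ∉ Ioo z.2 (2 * z.2) from h)]
    exact indicator_of_notMem
      (show (z, s) ∉ {z : (ℝ × ℝ) × ℝ | z.1.2 < z.2 ∧ z.2 < 2 * z.1.2} from h) _

theorem lintegral_remainder_le {p : ℝ≥0∞} (hp : 1 < p) {m : Measure ℝ} [IsFiniteMeasure m]
    {θ : ℝ → ℂ} (hθm : Measurable θ) (hθ : Integrable θ m) (γ : ℝ) :
    ∫⁻ x in Ioi 0, ENNReal.ofReal (2 * Real.pi * x)⁻¹ *
        ‖∫ s in Ioi 0, (remainderKernel γ x s : ℂ) * θ s ∂m‖ₑ ≤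
      ENNReal.ofReal ((Real.log 2)⁻¹ * ((4 * cutoffConst + 2) * bracketBound p)) *
        ∫⁻ u in Ioi (0 : ℝ), ENNReal.ofReal (u ^ (-(p⁻¹).toReal)) *
          starNorm p ((m.withDensityᵥ θ).restrict (Ioo u (2 * u))) := by
  have hl : 0 < Real.log 2 := Real.log_pos one_lt_two
  have hB := cutoffConst_pos
  have hW := bracketBound_pos p
  set J : ℝ → ℝ → ℂ := fun x u => ∫ s in Ioo u (2 * u), (remainderKernel γ x s : ℂ) * θ s ∂m
  have hJ : Measurable fun z : ℝ × ℝ => ‖J z.1 z.2‖ₑ :=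
    (measurable_setIntegral_remainderKernel hθm γ).enorm
  have hqm : ∀ x, Measurable fun s => (remainderKernel γ x s : ℂ) * θ s := fun x =>
    (Complex.measurable_ofReal.comp (Measurable.of_uncurry_left (f := remainderKernel γ)
      (measurable_remainderKernel γ))).mul hθm
  have hoct : ∀ u ∈ Ioi (0 : ℝ), ∫⁻ x in Ioi 0, ENNReal.ofReal (2 * Real.pi * x)⁻¹ * ‖J x u‖ₑ ≤
      ENNReal.ofReal ((4 * cutoffConst + 2) * (u ^ (1 - (p⁻¹).toReal) * bracketBound p)) *
        starNorm p ((m.withDensityᵥ θ).restrict (Ioo u (2 * u))) := by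
    intro u hu
    rw [withDensityᵥ_restrict hθ measurableSet_Ioo]
    exact lintegral_remainder_octave_le hp hθ.integrableOn hu
      (ae_restrict_mem measurableSet_Ioo) γ
  calc _ ≤ ∫⁻ x in Ioi (0 : ℝ), ENNReal.ofReal (Real.log 2)⁻¹ *
          ∫⁻ u in Ioi (0 : ℝ), ENNReal.ofReal u⁻¹ *
            (ENNReal.ofReal (2 * Real.pi * x)⁻¹ * ‖J x u‖ₑ) := by
        refine lintegral_mono fun x => ?_
        beta_reduce
        have h1 := enorm_setIntegral_Ioi_le_lintegral_octave (hqm x)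
          (integrable_remainderKernel_mul hθ γ x)
        refine (mul_le_mul_right h1 _).trans (le_of_eq ?_)
        rw [mul_left_comm, ← lintegral_const_mul' _ _ ENNReal.ofReal_ne_top]
        congr 2; ext u
        ring
    _ = ENNReal.ofReal (Real.log 2)⁻¹ * ∫⁻ u in Ioi (0 : ℝ), ENNReal.ofReal u⁻¹ *
          ∫⁻ x in Ioi (0 : ℝ), ENNReal.ofReal (2 * Real.pi * x)⁻¹ * ‖J x u‖ₑ := by
        rw [lintegral_const_mul' _ _ ENNReal.ofReal_ne_top, lintegral_lintegral_swap]
        · congr 2; ext u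
          rw [lintegral_const_mul' _ _ ENNReal.ofReal_ne_top]
        · refine Measurable.aemeasurable ?_
          refine Measurable.mul (by fun_prop) (Measurable.mul (by fun_prop) hJ)
    _ ≤ ENNReal.ofReal (Real.log 2)⁻¹ * ∫⁻ u in Ioi (0 : ℝ),
          ENNReal.ofReal ((4 * cutoffConst + 2) * bracketBound p) *
          (ENNReal.ofReal (u ^ (-(p⁻¹).toReal)) *
          starNorm p ((m.withDensityᵥ θ).restrict (Ioo u (2 * u)))) := by
        -- Pointwise comparison on `(0, ∞)` avoids any measurability of the star norm in `u`.
        refine mul_le_mul_right (setLIntegral_mono' measurableSet_Ioi fun u hu => ?_) _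
        refine (mul_le_mul_right (hoct u hu) _).trans (le_of_eq ?_)
        have hu0 : 0 < u := hu
        rw [← mul_assoc, ← ENNReal.ofReal_mul (by positivity), ← mul_assoc (ENNReal.ofReal (_ * _)),
          ← ENNReal.ofReal_mul (by positivity)]
        congr 2
        rw [sub_eq_add_neg, Real.rpow_add hu0, Real.rpow_one]
        field_simp
    _ = _ := by
        rw [lintegral_const_mul' _ _ ENNReal.ofReal_ne_top, ← mul_assoc,
          ← ENNReal.ofReal_mul (by positivity)]

theorem mainTheorem1 (p : ℝ≥0∞) (hp : 1 < p) :
    ∃ C : ℝ≥0, ∀ (f : ℝ → ℂ) (hf : BoundedVariationOn f (Ioi 0)),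
      Tendsto f atTop (𝓝 0) → vStarNorm p hf < ∞ →
      ∀ γ : ℝ, γ = 0 ∨ γ = 1 / 4 →
        ∃ F Γ : ℝ → ℂ, IsTrigTransform γ f F ∧
          (∀ x : ℝ, 0 < x →
            F x = (1 / (2 * Real.pi * x) : ℝ) * f (1 / x) * (Real.sin (2 * Real.pi * γ) : ℝ)
              + Γ x) ∧
          IntegrableOn Γ (Ioi 0) volume ∧
          eLpNorm Γ 1 (volume.restrict (Ioi 0)) ≤ C * vStarNorm p hf := by
  refine ⟨Real.toNNReal ((Real.log 2)⁻¹ * ((4 * cutoffConst + 2) * bracketBound p)), ?_⟩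
  intro f hf hlim hV γ _
  obtain ⟨m, θ, hm, hθm, hθ, hμ⟩ := exists_eq_withDensityᵥ (bvMeasure hf)
  have hfθ := ae_eq_neg_setIntegral_density hf hlim hθ hμ
  set F : ℝ → ℂ := fun x =>
    - ∫ s in Ioi 0, θ s * (((2 * Real.pi * x)⁻¹ * trigKernel γ (x * s) : ℝ) : ℂ) ∂m with hF
  -- Defined by subtraction, so that the formula holds at every `x > 0`. The kernel integral `G`
  -- agrees with it only almost everywhere, as `f(1/x)` may differ from the right limit at jumps.
  set Γ : ℝ → ℂ := fun x =>
    F x - (1 / (2 * Real.pi * x) : ℝ) * f (1 / x) * (Real.sin (2 * Real.pi * γ) : ℝ) with hΓ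
  set G : ℝ → ℂ := fun x => - (((2 * Real.pi * x)⁻¹ : ℝ) : ℂ) *
    ∫ s in Ioi 0, (remainderKernel γ x s : ℂ) * θ s ∂m with hG
  have hGm : Measurable G := by
    have h1 : Measurable fun z : ℝ × ℝ => (remainderKernel γ z.1 z.2 : ℂ) * θ z.2 :=
      (Complex.measurable_ofReal.comp (measurable_remainderKernel γ)).mul
        (hθm.comp measurable_snd)
    have h2 := (h1.stronglyMeasurable.integral_prod_right' (ν := m.restrict (Ioi 0))).measurable
    exact Measurable.mul (by fun_prop) h2
  have hΓG : Γ =ᵐ[volume.restrict (Ioi 0)] G := by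
    filter_upwards [ae_restrict_of_ae (ae_inv_of_ae hfθ), ae_restrict_mem measurableSet_Ioi]
      with x h1 hx
    have hx0 : 0 < 1 / x := one_div_pos.2 hx
    have h2 : ∫ s in Ioi (1 / x), θ s ∂(m.restrict (Ioi 0)) = ∫ s in Ioi (1 / x), θ s ∂m := by
      rw [Measure.restrict_restrict measurableSet_Ioi,
        inter_eq_self_of_subset_left (Ioi_subset_Ioi hx0.le)]
    have h3 : F x = - (((2 * Real.pi * x)⁻¹ : ℝ) : ℂ) *
        ∫ s in Ioi 0, (trigKernel γ (x * s) : ℂ) * θ s ∂m := by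
      simp only [hF]
      rw [neg_mul, ← MeasureTheory.integral_const_mul]
      congr 1
      refine integral_congr_ae (ae_of_all _ fun s => ?_)
      push_cast; ring
    simp only [hΓ, hG]
    rw [integral_remainderKernel_mul hθ.integrableOn, h2, h1 hx, h3, one_div]
    ring
  have hnorm : eLpNorm Γ 1 (volume.restrict (Ioi 0)) ≤
      (Real.toNNReal ((Real.log 2)⁻¹ * ((4 * cutoffConst + 2) * bracketBound p)) : ℝ≥0) *
        vStarNorm p hf := by
    rw [eLpNorm_congr_ae hΓG, eLpNorm_one_eq_lintegral_enorm]
    unfold vStarNorm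
    rw [hμ]
    refine le_trans (le_of_eq ?_) (lintegral_remainder_le hp hθm hθ γ)
    refine setLIntegral_congr_fun measurableSet_Ioi fun x hx => ?_
    have hx0 : 0 < x := hx
    simp only [hG]
    rw [neg_mul, enorm_neg, enorm_mul, ← ofReal_norm (((2 * Real.pi * x)⁻¹ : ℝ) : ℂ),
      Complex.norm_real, Real.norm_of_nonneg (by positivity)]
  refine ⟨F, Γ, fun x hx => ⟨fun R hR => ?_, ?_⟩, fun x _ => ?_, ?_, hnorm⟩
  · exact (setIntegral_mul_cos_eq hθm hθ hfθ hx γ hR).1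
  · exact tendsto_setIntegral_mul_cos hθm hθ hfθ hx γ
  · simp only [hΓ]; ring
  · rw [IntegrableOn, ← memLp_one_iff_integrable]
    exact ⟨hGm.aestronglyMeasurable.congr hΓG.symm,
      hnorm.trans_lt (ENNReal.mul_lt_top ENNReal.coe_lt_top hV)⟩
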